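/- Let $(X,h_X)$ be an isotropic $L$-space: a commutative additive monoid with zero $\theta$ and a multiplication by real numbers satisfying $\alpha(x+y)=\alpha x+\alpha y$, $\alpha(\beta x)=(\alpha\beta)x$, $1x=x$, $0x=\theta$, endowed with a complete separable metric $h_X$ such that $h_X(\alpha x,\alpha y)=|\alpha|h_X(x,y)$ and $h_X(x+z,y+z)=h_X(x,y)$. Write $\|x\|_X=h_X(x,\theta)$. Let $X^{\rm c}=\{x:(\alpha+\beta)x=\alpha x+\beta x\ \ \forall\alpha,\beta\ge 0\}$ be the set of convex elements and $X^{\rm inv}$ the set of elements $x$ with $x+x'=\theta$ for some $x'\in X$; assume $X^{\rm inv}\cap X^{\rm c}\ne\{\theta\}$. Let $P\colon X\to X^{\rm c}$ be a convexifying operator, i.e. surjective, with $P\circ P=P$, $h_X(Px,Py)\le h_X(x,y)$ and $P(\alpha x+\beta y)=\alpha Px+\beta Py$ for all $x,y\in X$, $\alpha,\beta\in\mathbb R$. The integral of a simple function with values $f_i$ on pairwise disjoint measurable sets $T_i$ is $\sum_i \mu(T_i)P(f_i)$, where $\mu$ is Lebesgue measure, and the integral of a uniform limit of simple functions is the limit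 of the integrals. Let $a<b$ and let $\omega\colon[0,\infty)\to\mathbb R$ be a modulus of continuity (non-decreasing, continuous, subadditive, $\omega(0)=0$), not identically zero; put $I(\alpha)=\int_0^\alpha\omega(s)\,ds$. Let $H^\omega([a,b],X)$ be the set of $\phi\colon[a,b]\to X$ with $h_X(\phi(s),\phi(t))\le\omega(|s-t|)$ for all $s,t\in[a,b]$, let $W^1H^\omega([a,b],X)$ be the set of functions $f(t)=x+\int_a^t\phi(s)\,ds$ with $x\in X^{\rm c}$, $\phi\in H^\omega([a,b],X)$, and let $\overline W^1H^\omega=\bigcup_{k>0}k\cdot W^1H^\omega$. The Hukuhara type difference $x-_Hy$ is the element $z$ with $x=y+z$ (unique if it exists). The Hukuhara type derivative $\mathcal D_Hf(t)$ is the common limit as $\gamma\to+0$ of $\gamma^{-1}(f(t+\gamma)-_Hf(t))$ and $\gamma^{-1}(f(t)-_Hf(t-\gamma))$, where the differences are required to exist for all small $\gamma>0$ (only one of the two limits is taken at an endpoint of $[a,b]$), and $$\Delta^H_{\gamma_1,\gamma_2}f(t)=\frac{f(t+\gamma_2)-_Hf(t-\gamma_1)}{\gamma_1+\gamma_2}.$$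 Let $$\|g\|_{\omega,X}=\sup_{s\ne t}\frac{h_X(g(s),g(t))}{\omega(|s-t|)},\qquad \|f\|_{C}=\sup_{t\in[a,b]}\|f(t)\|_X,$$ where $s,t$ in the first supremum range over $[a,b]$, and $$K(\gamma_1,\gamma_2;h_1,h_2)=\frac{(h_1-\gamma_1)+(h_2-\gamma_2)}{(h_1+h_2)^2}\left\{I\!\left(\frac{(h_1+h_2)(h_1-\gamma_1)}{(h_1-\gamma_1)+(h_2-\gamma_2)}\right)+I\!\left(\frac{(h_1+h_2)(h_2-\gamma_2)}{(h_1-\gamma_1)+(h_2-\gamma_2)}\right)\right\},$$ with $K(h_1,h_2;h_1,h_2)=0$. 1. For every $f\in\overline W^1H^\omega([a,b],X)$ the derivative $\mathcal D_Hf$ exists on $[a,b]$ and $\|\mathcal D_Hf\|_{\omega,X}$, $\|f\|_C$ are finite. For all $t\in[a,b]$ and all non-negative $\gamma_1,\gamma_2,h_1,h_2$ with $\gamma_1+\gamma_2>0$, $h_1+h_2>0$ and $[t-\gamma_1,t+\gamma_2]\subset[t-h_1,t+h_2]\subset[a,b]$, the divided difference exists and $$\|\Delta^H_{\gamma_1,\gamma_2}f(t)\|_X\le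 K(\gamma_1,\gamma_2;h_1,h_2)\,\|\mathcal D_Hf\|_{\omega,X}+\frac{2}{h_1+h_2}\|f\|_C, \tag{d}$$ $$\|\mathcal D_Hf(t)\|_X\le\frac{I(h_1)+I(h_2)}{h_1+h_2}\,\|\mathcal D_Hf\|_{\omega,X}+\frac{2}{h_1+h_2}\|f\|_C. \tag{e}$$ 2. If $\omega$ is concave, $t\in[a,b]$, $h>\gamma>0$, and $\gamma_1=\min\{\gamma,t-a\}$, $\gamma_2=\min\{\gamma,b-t\}$, $h_1=\min\{h,t-a\}$, $h_2=\min\{h,b-t\}$, then (d) is sharp: it is an equality for some $f\in W^1H^\omega([a,b],X)$ with $\|\mathcal D_Hf\|_{\omega,X}=1$ and $\|f\|_C>0$. 3. For an arbitrary modulus of continuity $\omega$ as above, if $t\in[a,b]$, $h>0$, and $h_1=\min\{h,t-a\}$, $h_2=\min\{h,b-t\}$, then (e) is sharp: it is an equality for some $f\in W^1H^\omega([a,b],X)$ with $\|\mathcal D_Hf\|_{\omega,X}=1$ and $\|f\|_C>0$. -/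

import Mathlib

open Set Filter Topology MeasureTheory

/-- A semilinear space: a commutative additive monoid with zero `θ`, and a multiplication by real
numbers with `α (x + y) = α x + α y`, `α (β x) = (α β) x`, `1 x = x` and `0 x = θ`.  The law
`(α + β) x = α x + β x` is not required. -/
class SemilinearSpace (X : Type*) extends AddCommMonoid X, MulAction ℝ X where
  smul_add_semilinear : ∀ (α : ℝ) (x y : X), α • (x + y) = α • x + α • y
  zero_smul_semilinear : ∀ x : X, (0 : ℝ) • x = 0

/-- An `L`-space: a semilinear space with a complete separable metric that is absolutely
homogeneous and does not increase under translations. -/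
class LSpace (X : Type*) extends SemilinearSpace X, MetricSpace X where
  complete_lspace : CompleteSpace X
  separable_lspace : TopologicalSpace.SeparableSpace X
  dist_smul_lspace : ∀ (α : ℝ) (x y : X), dist (α • x) (α • y) = |α| * dist x y
  dist_add_right_le_lspace : ∀ x y z : X, dist (x + z) (y + z) ≤ dist x y

/-- The `L`-space is isotropic: its metric is translation invariant. -/
def IsIsotropic (X : Type*) [LSpace X] : Prop :=
  ∀ x y z : X, dist (x + z) (y + z) = dist x y

/-- The set of convex elements of `X`. -/
def convexElements (X : Type*) [LSpace X] : Set X :=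
  {x | ∀ α β : ℝ, 0 ≤ α → 0 ≤ β → (α + β) • x = α • x + β • x}

/-- The set of invertible elements of `X`. -/
def invertibleElements (X : Type*) [LSpace X] : Set X :=
  {x | ∃ x' : X, x + x' = 0}

/-- `P` is a convexifying operator: a nonexpansive idempotent linear surjection of `X` onto the
set of convex elements. -/
structure IsConvexifying {X : Type*} [LSpace X] (P : X → X) : Prop where
  mem_convex : ∀ x, P x ∈ convexElements X
  surj : ∀ y ∈ convexElements X, ∃ x, P x = y
  dist_le : ∀ x y, dist (P x) (P y) ≤ dist x y
  idem : ∀ x, P (P x) = P x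
  linear : ∀ (α β : ℝ) (x y : X), P (α • x + β • y) = α • P x + β • P y

/-- The integral over `[a, b]` of a simple function: `∑ P(y) · mes {t ∈ [a, b] : F t = y}`,
summed over the finitely many values `y` of `F`. -/
noncomputable def simpleIntegral {X : Type*} [LSpace X] (P : X → X) (F : SimpleFunc ℝ X)
    (a b : ℝ) : X :=
  ∑ y ∈ F.range, (volume (F ⁻¹' {y} ∩ Icc a b)).toReal • P y

/-- `J` is the integral of `f` over `[a, b]`: the limit of the integrals of a sequence of simple
functions that converges to `f` uniformly on `[a, b]`. -/
def HasLIntegral {X : Type*} [LSpace X] (P : X → X) (f : ℝ → X) (a b : ℝ) (J : X) : Prop :=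
  ∃ F : ℕ → SimpleFunc ℝ X,
    TendstoUniformlyOn (fun n t => F n t) f atTop (Icc a b) ∧
    Tendsto (fun n => simpleIntegral P (F n) a b) atTop (𝓝 J)

/-- `ω` (of which only the values on `[0, ∞)` matter) is a modulus of continuity. -/
structure IsModulus (ω : ℝ → ℝ) : Prop where
  map_zero : ω 0 = 0
  continuousOn : ContinuousOn ω (Ici 0)
  monotoneOn : MonotoneOn ω (Ici 0)
  subadditive : ∀ s t : ℝ, 0 ≤ s → 0 ≤ t → ω (s + t) ≤ ω s + ω t

/-- The class `H^ω([a, b], X)`. -/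
def MemH {X : Type*} [LSpace X] (ω : ℝ → ℝ) (a b : ℝ) (φ : ℝ → X) : Prop :=
  ∀ s ∈ Icc a b, ∀ t ∈ Icc a b, dist (φ s) (φ t) ≤ ω |s - t|

/-- The class `W¹H^ω([a, b], X)` of functions `f(t) = x + ∫_a^t φ(s) ds` on `[a, b]`, with `x`
convex and `φ ∈ H^ω([a, b], X)`. -/
def MemW {X : Type*} [LSpace X] (P : X → X) (ω : ℝ → ℝ) (a b : ℝ) (f : ℝ → X) : Prop :=
  ∃ φ : ℝ → X, MemH ω a b φ ∧ ∃ x ∈ convexElements X,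
    ∀ t ∈ Icc a b, ∃ J, HasLIntegral P φ a t J ∧ f t = x + J

/-- The class `⋃_{k > 0} k · W¹H^ω([a, b], X)`. -/
def MemWBar {X : Type*} [LSpace X] (P : X → X) (ω : ℝ → ℝ) (a b : ℝ) (f : ℝ → X) : Prop :=
  ∃ k : ℝ, 0 < k ∧ ∃ g : ℝ → X, MemW P ω a b g ∧ ∀ t ∈ Icc a b, f t = k • g t

/-- `z` is the Hukuhara type difference of `x` and `y`. -/
def IsHukuharaDiff {X : Type*} [LSpace X] (x y z : X) : Prop :=
  x = y + z

open Classical in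
/-- The Hukuhara type difference of `x` and `y` (`θ` if there is none); it is unique when `X` is
isotropic. -/
noncomputable def hukuharaDiff {X : Type*} [LSpace X] (x y : X) : X :=
  if h : ∃ z, IsHukuharaDiff x y z then h.choose else 0

/-- `f : [a, b] → X` has the Hukuhara type derivative `d` at `t ∈ [a, b]`: the one-sided
difference quotients exist for small steps and tend to `d`, from both sides if `a < t < b` and
from the only available side if `t` is an endpoint. -/
def HasHukuharaDeriv {X : Type*} [LSpace X] (a b : ℝ) (f : ℝ → X) (t : ℝ) (d : X) : Prop :=
  (t < b →
    (∀ᶠ γ in 𝓝[>] (0 : ℝ), ∃ z, IsHukuharaDiff (f (t + γ)) (f t) z) ∧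
    Tendsto (fun γ : ℝ => γ⁻¹ • hukuharaDiff (f (t + γ)) (f t)) (𝓝[>] 0) (𝓝 d)) ∧
  (a < t →
    (∀ᶠ γ in 𝓝[>] (0 : ℝ), ∃ z, IsHukuharaDiff (f t) (f (t - γ)) z) ∧
    Tendsto (fun γ : ℝ => γ⁻¹ • hukuharaDiff (f t) (f (t - γ))) (𝓝[>] 0) (𝓝 d))

open Classical in
/-- The Hukuhara type derivative of `f : [a, b] → X` at `t` (`θ` if there is none). -/
noncomputable def hukuharaDeriv {X : Type*} [LSpace X] (a b : ℝ) (f : ℝ → X) (t : ℝ) : X :=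
  if h : ∃ d, HasHukuharaDeriv a b f t d then h.choose else 0

/-- The Hukuhara type divided difference `(f(t + γ₂) - f(t - γ₁)) / (γ₁ + γ₂)`. -/
noncomputable def dividedDiff {X : Type*} [LSpace X] (γ₁ γ₂ : ℝ) (f : ℝ → X) (t : ℝ) : X :=
  (γ₁ + γ₂)⁻¹ • hukuharaDiff (f (t + γ₂)) (f (t - γ₁))

/-- `‖x‖ = h(x, θ)`. -/
noncomputable def normL {X : Type*} [LSpace X] (x : X) : ℝ :=
  dist x 0

/-- The values `‖f(t)‖`, `t ∈ [a, b]`. -/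
def normValues {X : Type*} [LSpace X] (a b : ℝ) (f : ℝ → X) : Set ℝ :=
  {r | ∃ t ∈ Icc a b, r = normL (f t)}

/-- `‖f‖_C`, the supremum of `‖f(t)‖` over `t ∈ [a, b]`. -/
noncomputable def normC {X : Type*} [LSpace X] (a b : ℝ) (f : ℝ → X) : ℝ :=
  sSup (normValues a b f)

/-- The quotients `h(g(s), g(t)) / ω(|s - t|)`, for distinct `s, t ∈ [a, b]`. -/
def omegaQuotients {X : Type*} [LSpace X] (ω : ℝ → ℝ) (a b : ℝ) (g : ℝ → X) : Set ℝ :=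
  {r | ∃ s ∈ Icc a b, ∃ t ∈ Icc a b, s ≠ t ∧ r = dist (g s) (g t) / ω |s - t|}

/-- `‖g‖_ω`, the supremum of `h(g(s), g(t)) / ω(|s - t|)` over distinct `s, t ∈ [a, b]`. -/
noncomputable def normOmega {X : Type*} [LSpace X] (ω : ℝ → ℝ) (a b : ℝ) (g : ℝ → X) : ℝ :=
  sSup (omegaQuotients ω a b g)

/-- `I(α) = ∫_0^α ω(s) ds`. -/
noncomputable def modulusIntegral (ω : ℝ → ℝ) (α : ℝ) : ℝ :=
  ∫ s in (0 : ℝ)..α, ω s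

/-- The constant `K(γ₁, γ₂; h₁, h₂)`; it is `0` if `γ₁ = h₁` and `γ₂ = h₂`. -/
noncomputable def landauK (ω : ℝ → ℝ) (γ₁ γ₂ h₁ h₂ : ℝ) : ℝ :=
  ((h₁ - γ₁) + (h₂ - γ₂)) / (h₁ + h₂) ^ 2 *
    (modulusIntegral ω ((h₁ + h₂) * (h₁ - γ₁) / ((h₁ - γ₁) + (h₂ - γ₂))) +
     modulusIntegral ω ((h₁ + h₂) * (h₂ - γ₂) / ((h₁ - γ₁) + (h₂ - γ₂))))

/-! On convex elements the distributive law holds for nonnegative scalars, and translation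
invariance of the metric gives cancellation. The convex elements therefore form a cone that embeds
isometrically in a Banach space `B` (`exists_isConeEmbedding`); composed with `P`, the embedding `j`
is defined on all of `X` and turns the integral into the Bochner integral. The embedded cone is
closed and convex, so it contains the integrals over intervals of continuous functions with values
in it. This is why the Hukuhara differences of a primitive exist, and the fundamental theorem of
calculus in `B` identifies the derivative with the `P`-image of the density.

Both inequalities compare means of the derivative. The divided difference is its mean over the inner
interval, while its mean over the outer interval is an increment of `f` divided by `h₁ + h₂`, hence
of norm at most `2 ‖f‖_C / (h₁ + h₂)`. The difference of the two means is an integral in which each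
point of the gaps between the intervals is paired with a point of the inner one
(`average_sub_average`). Bounding each pair by `ω` of its distance yields `K`. For the derivative
the inner interval is a single point (`sub_average`).

Sharpness is a problem about real functions, carried into `X` along the line through an invertible
convex element. If `φ ≥ 0` and the primitive is centred so that its values at `a` and `b` are
opposite, then `‖f‖_C` is half of `∫ φ` (`IsExtremalDensity.exists_memW`). Equality holds once `φ`
vanishes off the outer interval and its paired differences equal `ω` of the distance. A tent `ω(H) -
ω(|s - t|)` cut off at zero does this for the derivative with any modulus. For divided differences
the function is built from `concaveDrop`, and concavity is what keeps it in the class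
(`concaveDrop_sub_le`). -/

section Algebra

/-! ### Algebra of isotropic spaces and of the convexifying operator. -/

variable {X : Type*} [LSpace X]

theorem SemilinearSpace.real_smul_zero (α : ℝ) : α • (0 : X) = 0 := by
  rw [← SemilinearSpace.zero_smul_semilinear (0 : X), smul_smul, mul_zero]

theorem SemilinearSpace.smul_finset_sum {ι : Type*} (α : ℝ) (s : Finset ι) (g : ι → X) :
    α • ∑ i ∈ s, g i = ∑ i ∈ s, α • g i := by
  classical
  induction s using Finset.induction_on with
  | empty => simp [SemilinearSpace.real_smul_zero]
  | insert i s hi ih =>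
    rw [Finset.sum_insert hi, Finset.sum_insert hi, SemilinearSpace.smul_add_semilinear, ih]

theorem IsIsotropic.add_right_cancel (hX : IsIsotropic X) {x y z : X} (h : x + z = y + z) :
    x = y := by
  rw [← dist_eq_zero, ← hX x y z, h, dist_self]

theorem IsIsotropic.dist_add_add_le (hX : IsIsotropic X) (x y x' y' : X) :
    dist (x + x') (y + y') ≤ dist x y + dist x' y' := by
  refine (dist_triangle _ (y + x') _).trans ?_
  rw [hX x y x', add_comm y x', add_comm y y', hX x' y' y]

namespace IsConvexifying

variable {P : X → X} (hP : IsConvexifying P)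
include hP

theorem map_add (x y : X) : P (x + y) = P x + P y := by
  simpa using hP.linear 1 1 x y

theorem map_smul (α : ℝ) (x : X) : P (α • x) = α • P x := by
  simpa [SemilinearSpace.zero_smul_semilinear] using hP.linear α 0 x x

theorem map_zero : P 0 = 0 := by
  have h := hP.map_smul 0 0
  rwa [SemilinearSpace.zero_smul_semilinear, SemilinearSpace.zero_smul_semilinear] at h

theorem map_finset_sum {ι : Type*} (s : Finset ι) (g : ι → X) :
    P (∑ i ∈ s, g i) = ∑ i ∈ s, P (g i) := by
  classical
  induction s using Finset.induction_on with
  | empty => simp [hP.map_zero]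
  | insert i s hi ih => rw [Finset.sum_insert hi, Finset.sum_insert hi, hP.map_add, ih]

theorem map_eq_self {x : X} (hx : x ∈ convexElements X) : P x = x := by
  obtain ⟨y, rfl⟩ := hP.surj x hx
  exact hP.idem y

theorem continuous : Continuous P :=
  LipschitzWith.continuous (LipschitzWith.mk_one hP.dist_le)

end IsConvexifying

end Algebra

universe u

/-! ### Embedding of the cone of convex elements in a Banach space. -/

section Embedding

variable {X : Type*} [LSpace X]

/-- The element `∑ r⁺ P x` represented by the positive part of a formal combination `∑ r x`. -/
noncomputable def positiveSum (P : X → X) (v : X →₀ ℝ) : X :=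
  v.sum fun x r => (max r 0) • P x

theorem positiveSum_eq_sum (P : X → X) (v : X →₀ ℝ) {s : Finset X} (hs : v.support ⊆ s) :
    positiveSum P v = ∑ x ∈ s, (max (v x) 0) • P x :=
  Finsupp.sum_of_support_subset _ hs _ fun x _ => by
    simp [SemilinearSpace.zero_smul_semilinear]

/-- This is additivity of `v ↦ v⁺ - v⁻`, rearranged so that no subtraction occurs. It reduces to the
same identity for real coefficients, because nonnegative multiples of the convex element `P x` may
be collected. -/
theorem positiveSum_add {P : X → X} (hP : IsConvexifying P) (v w : X →₀ ℝ) :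
    positiveSum P (v + w) + (positiveSum P (-v) + positiveSum P (-w)) =
      positiveSum P (-(v + w)) + (positiveSum P v + positiveSum P w) := by
  classical
  have hvw : (v + w).support ⊆ v.support ∪ w.support := Finsupp.support_add
  rw [positiveSum_eq_sum P (v + w) hvw,
    positiveSum_eq_sum P (-(v + w)) (s := v.support ∪ w.support) (by rwa [Finsupp.support_neg]),
    positiveSum_eq_sum P v (s := v.support ∪ w.support) Finset.subset_union_left,
    positiveSum_eq_sum P w (s := v.support ∪ w.support) Finset.subset_union_right,
    positiveSum_eq_sum P (-v) (s := v.support ∪ w.support)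
      (by rw [Finsupp.support_neg]; exact Finset.subset_union_left),
    positiveSum_eq_sum P (-w) (s := v.support ∪ w.support)
      (by rw [Finsupp.support_neg]; exact Finset.subset_union_right)]
  simp only [← Finset.sum_add_distrib]
  refine Finset.sum_congr rfl fun x _ => ?_
  have hc := hP.mem_convex x
  simp only [Finsupp.coe_add, Finsupp.coe_neg, Pi.add_apply, Pi.neg_apply]
  generalize v x = r
  generalize w x = s
  rw [← hc _ _ (le_max_right _ _) (le_max_right _ _), ← hc _ _ (le_max_right _ _) (by positivity),
    ← hc _ _ (le_max_right _ _) (le_max_right _ _), ← hc _ _ (le_max_right _ _) (by positivity)]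
  congr 1
  have key : ∀ t : ℝ, max t 0 - max (-t) 0 = t := fun t => by
    rcases le_total t 0 with h | h
    · rw [max_eq_right h, max_eq_left (by linarith)]; ring
    · rw [max_eq_left h, max_eq_right (by linarith)]; ring
  linarith [key r, key s, key (r + s)]

theorem positiveSum_smul (P : X → X) {c : ℝ} (hc : 0 ≤ c) (v : X →₀ ℝ) :
    positiveSum P (c • v) = c • positiveSum P v := by
  rw [positiveSum_eq_sum P (c • v) (s := v.support) Finsupp.support_smul,
    positiveSum_eq_sum P v (Finset.Subset.refl _), SemilinearSpace.smul_finset_sum]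
  refine Finset.sum_congr rfl fun x _ => ?_
  rw [smul_smul, mul_max_of_nonneg _ _ hc]
  simp

theorem positiveSum_single (P : X → X) (x : X) (r : ℝ) :
    positiveSum P (Finsupp.single x r) = (max r 0) • P x :=
  Finsupp.sum_single_index (by simp [SemilinearSpace.zero_smul_semilinear])

/-- The seminorm `h(∑ r⁺ P x, ∑ r⁻ P x)` of a formal combination `∑ r x`. -/
noncomputable def formalSeminorm (hX : IsIsotropic X) {P : X → X} (hP : IsConvexifying P) :
    Seminorm ℝ (X →₀ ℝ) :=
  Seminorm.of (fun v => dist (positiveSum P v) (positiveSum P (-v)))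
    (fun v w => by
      -- Translating both points by the negative parts of `v` and `w` makes the additivity identity
      -- applicable; the common summand then cancels by isotropy.
      rw [← hX _ _ (positiveSum P (-v) + positiveSum P (-w)), positiveSum_add hP,
        add_comm, add_comm (positiveSum P (-(v + w))), hX]
      exact hX.dist_add_add_le _ _ _ _)
    (fun c v => by
      have key : ∀ c : ℝ, 0 ≤ c → ∀ v : X →₀ ℝ,
          dist (positiveSum P (c • v)) (positiveSum P (-(c • v))) =
            |c| * dist (positiveSum P v) (positiveSum P (-v)) := fun c hc v => by
        rw [← smul_neg, positiveSum_smul P hc, positiveSum_smul P hc, LSpace.dist_smul_lspace]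
      -- A negative scalar exchanges the positive and the negative part, and the distance is
      -- symmetric.
      rcases le_total 0 c with hc | hc
      · exact key c hc v
      · have h := key (-c) (by linarith) v
        rwa [neg_smul, neg_neg, dist_comm, abs_neg] at h)

/-- `j` maps `X` into a normed space, is additive and positively homogeneous, and
`‖j x - j y‖ = h(P x, P y)`; so it is an isometric embedding of the cone of convex elements. -/
structure IsConeEmbedding {B : Type*} [NormedAddCommGroup B] [NormedSpace ℝ B] (P : X → X)
    (j : X → B) : Prop where
  norm_sub : ∀ x y, ‖j x - j y‖ = dist (P x) (P y)
  map_add : ∀ x y, j (x + y) = j x + j y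
  map_smul : ∀ (α : ℝ) (x : X), 0 ≤ α → j (α • x) = α • j x

/-- The space `B` is the completion of the formal combinations under the seminorm, and `j` sends `x`
to the generator at `x`. It identifies `x` with `P x`, and so is injective only on convex elements.
-/
theorem exists_isConeEmbedding {X : Type u} [LSpace X] (hX : IsIsotropic X) {P : X → X}
    (hP : IsConvexifying P) :
    ∃ (B : Type u) (_ : NormedAddCommGroup B) (_ : NormedSpace ℝ B) (_ : CompleteSpace B)
      (j : X → B), IsConeEmbedding P j := by
  let p := formalSeminorm hX hP
  let _ : SeminormedAddCommGroup (X →₀ ℝ) := p.toAddGroupSeminorm.toSeminormedAddCommGroup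
  let _ : NormedSpace ℝ (X →₀ ℝ) := ⟨fun c v => (map_smul_eq_mul p c v).le⟩
  have hn : ∀ v : X →₀ ℝ, ‖v‖ = dist (positiveSum P v) (positiveSum P (-v)) := fun v => rfl
  -- The completion is separated, so the linear relations for `j` need only hold up to seminorm
  -- zero.
  have hzero : ∀ v w : X →₀ ℝ, ‖v - w‖ = 0 →
      (v : UniformSpace.Completion (X →₀ ℝ)) = w := fun v w h => by
    rw [← sub_eq_zero, ← norm_eq_zero, ← UniformSpace.Completion.coe_sub,
      UniformSpace.Completion.norm_coe, h]
  have hpair : ∀ v w : X →₀ ℝ, ‖v - w‖ =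
      dist (positiveSum P v + positiveSum P (-w)) (positiveSum P (-v) + positiveSum P w) := by
    intro v w
    have h := positiveSum_add hP v (-w)
    rw [neg_neg, ← sub_eq_add_neg] at h
    rw [hn, ← hX _ _ (positiveSum P (-v) + positiveSum P w), h,
      add_comm (positiveSum P (-(v - w))), add_comm (positiveSum P (-(v - w))), hX]
  have hs : ∀ x r, 0 ≤ r → positiveSum P (Finsupp.single x r) = r • P x := fun x r hr => by
    rw [positiveSum_single, max_eq_left hr]
  have hs' : ∀ x r, 0 ≤ r → positiveSum P (-Finsupp.single x r) = 0 := fun x r hr => by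
    rw [← Finsupp.single_neg, positiveSum_single, max_eq_right (by linarith),
      SemilinearSpace.zero_smul_semilinear]
  refine ⟨UniformSpace.Completion (X →₀ ℝ), inferInstance, inferInstance, inferInstance,
    fun x => ((Finsupp.single x 1 : X →₀ ℝ) : UniformSpace.Completion (X →₀ ℝ)), ?_, ?_, ?_⟩
  · intro x y
    rw [← UniformSpace.Completion.coe_sub, UniformSpace.Completion.norm_coe, hpair,
      hs x 1 zero_le_one, hs' x 1 zero_le_one, hs y 1 zero_le_one, hs' y 1 zero_le_one]
    simp
  · intro x y
    rw [← UniformSpace.Completion.coe_add]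
    refine hzero _ _ ?_
    have h := positiveSum_add hP (Finsupp.single x 1) (Finsupp.single y 1)
    rw [hs x 1 zero_le_one, hs' x 1 zero_le_one, hs y 1 zero_le_one, hs' y 1 zero_le_one] at h
    rw [hpair, hs _ 1 zero_le_one, hs' _ 1 zero_le_one, dist_eq_zero]
    simp only [one_smul, add_zero, zero_add, hP.map_add] at h ⊢
    rw [h, add_comm]
  · intro α x hα
    rw [← UniformSpace.Completion.coe_smul]
    refine hzero _ _ ?_
    rw [hpair, Finsupp.smul_single, smul_eq_mul, mul_one, hs _ 1 zero_le_one,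
      hs' _ 1 zero_le_one, hs _ α hα, hs' _ α hα, hP.map_smul]
    simp

end Embedding

/-! ### Integration through the embedding. -/

namespace IsConeEmbedding

variable {X : Type*} [LSpace X] {P : X → X} {B : Type*} [NormedAddCommGroup B] [NormedSpace ℝ B]
  {j : X → B}

theorem map_zero (hj : IsConeEmbedding P j) : j 0 = 0 := by
  simpa using hj.map_add 0 0

theorem map_finset_sum (hj : IsConeEmbedding P j) {ι : Type*} (s : Finset ι) (g : ι → X) :
    j (∑ i ∈ s, g i) = ∑ i ∈ s, j (g i) := by
  classical
  induction s using Finset.induction_on with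
  | empty => simp [hj.map_zero]
  | insert i s hi ih => rw [Finset.sum_insert hi, Finset.sum_insert hi, hj.map_add, ih]

theorem map_convexifying (hj : IsConeEmbedding P j) (hP : IsConvexifying P) (x : X) :
    j (P x) = j x := by
  rw [← sub_eq_zero, ← norm_eq_zero, hj.norm_sub, hP.idem, dist_self]

theorem continuous (hj : IsConeEmbedding P j) (hP : IsConvexifying P) : Continuous j := by
  refine LipschitzWith.continuous (LipschitzWith.mk_one fun x y => ?_)
  rw [dist_eq_norm, hj.norm_sub]
  exact hP.dist_le x y

theorem dist_eq (hj : IsConeEmbedding P j) {x y : X} (hx : P x = x) (hy : P y = y) :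
    dist x y = ‖j x - j y‖ := by
  rw [hj.norm_sub, hx, hy]

theorem eq_of_map_eq (hj : IsConeEmbedding P j) {x y : X} (hx : P x = x) (hy : P y = y)
    (h : j x = j y) : x = y := by
  rw [← dist_eq_zero, hj.dist_eq hx hy, h, sub_self, norm_zero]

theorem normL_eq (hj : IsConeEmbedding P j) (hP : IsConvexifying P) {x : X} (hx : P x = x) :
    normL x = ‖j x‖ := by
  rw [normL, hj.dist_eq hx hP.map_zero, hj.map_zero, sub_zero]

theorem convex_range (hj : IsConeEmbedding P j) : Convex ℝ (range j) := by
  rintro _ ⟨x, rfl⟩ _ ⟨y, rfl⟩ α β hα hβ _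
  exact ⟨α • x + β • y, by rw [hj.map_add, hj.map_smul _ _ hα, hj.map_smul _ _ hβ]⟩

/-- The range of `j` is the image of the fixed-point set of `P`. That set is closed in a complete
space, and `j` is isometric on it. -/
theorem isClosed_range (hj : IsConeEmbedding P j) (hP : IsConvexifying P) :
    IsClosed (range j) := by
  have := LSpace.complete_lspace (X := X)
  have hr : range j = (fun x : range P => j x) '' univ := by
    ext y
    constructor
    · rintro ⟨x, rfl⟩
      exact ⟨⟨P x, x, rfl⟩, mem_univ _, hj.map_convexifying hP x⟩
    · rintro ⟨x, _, rfl⟩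
      exact ⟨_, rfl⟩
  have hc : IsClosed (range P) := by
    have : range P = {x | P x = x} := by
      ext y
      exact ⟨by rintro ⟨x, rfl⟩; exact hP.idem x, fun h => ⟨y, h⟩⟩
    rw [this]
    exact isClosed_eq hP.continuous continuous_id
  have : CompleteSpace (range P) := hc.completeSpace_coe
  have hiso : Isometry (fun x : range P => j x) := by
    refine Isometry.of_dist_eq ?_
    rintro ⟨_, x, rfl⟩ ⟨_, y, rfl⟩
    rw [dist_eq_norm, hj.norm_sub, hP.idem, hP.idem]
    rfl
  rw [hr, image_univ]
  exact hiso.isClosedEmbedding.isClosed_range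

/-- The embedded cone is closed under integration. -/
theorem exists_map_eq_integral [CompleteSpace B] (hj : IsConeEmbedding P j)
    (hP : IsConvexifying P) {c d : ℝ} (hcd : c ≤ d) {g : ℝ → X}
    (hg : ContinuousOn (fun s => j (g s)) (Icc c d)) :
    ∃ z, P z = z ∧ j z = ∫ s in c..d, j (g s) := by
  suffices h : ∃ z, j z = ∫ s in c..d, j (g s) by
    obtain ⟨z, hz⟩ := h
    exact ⟨P z, hP.idem z, by rw [hj.map_convexifying hP, hz]⟩
  rcases hcd.eq_or_lt with rfl | hlt
  · exact ⟨0, by simp [hj.map_zero]⟩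
  have hv : volume (Ioc c d) = ENNReal.ofReal (d - c) := Real.volume_Ioc
  have hi : IntegrableOn (fun s => j (g s)) (Ioc c d) :=
    (hg.integrableOn_Icc).mono_set Ioc_subset_Icc_self
  -- A mean of points of a closed convex set stays in the set; rescaling by the length `d - c` gives
  -- the integral, since the range is a cone.
  have hmem := hj.convex_range.set_average_mem (hj.isClosed_range hP) (μ := volume)
    (t := Ioc c d) (f := fun s => j (g s)) (by rw [hv]; simpa using hlt) (by rw [hv]; simp)
    (Eventually.of_forall fun s => ⟨g s, rfl⟩) hi
  obtain ⟨z, hz⟩ := hmem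
  refine ⟨(d - c) • z, ?_⟩
  rw [hj.map_smul _ _ (by linarith), hz, setAverage_eq, intervalIntegral.integral_of_le hcd,
    smul_smul, measureReal_def, hv, ENNReal.toReal_ofReal (by linarith),
    mul_inv_cancel₀ (by linarith), one_smul]

theorem map_simpleIntegral [CompleteSpace B] (hj : IsConeEmbedding P j) (hP : IsConvexifying P)
    (F : SimpleFunc ℝ X) (a b : ℝ) :
    j (simpleIntegral P F a b) = ∫ s in Icc a b, j (F s) := by
  classical
  have hF : ∀ s, j (F s) = ∑ y ∈ F.range, (F ⁻¹' {y}).indicator (fun _ => j y) s := by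
    intro s
    rw [Finset.sum_eq_single (F s)]
    · simp
    · intro y _ hy
      exact indicator_of_notMem (fun h => hy (by simpa using h.symm)) _
    · intro h
      exact absurd (F.mem_range_self s) h
  simp only [hF]
  rw [integral_finsetSum]
  · rw [simpleIntegral, hj.map_finset_sum]
    refine Finset.sum_congr rfl fun y _ => ?_
    rw [hj.map_smul _ _ ENNReal.toReal_nonneg, hj.map_convexifying hP,
      integral_indicator (F.measurableSet_fiber y), setIntegral_const, measureReal_def,
      Measure.restrict_apply (F.measurableSet_fiber y)]
  · intro y _
    exact (integrable_const (j y)).indicator (F.measurableSet_fiber y)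

theorem convexifying_simpleIntegral (hP : IsConvexifying P) (F : SimpleFunc ℝ X) (a b : ℝ) :
    P (simpleIntegral P F a b) = simpleIntegral P F a b := by
  simp only [simpleIntegral, hP.map_finset_sum, hP.map_smul, hP.idem]

omit [LSpace X] [NormedSpace ℝ B] in
theorem integrableOn_simpleFunc (j : X → B) (F : SimpleFunc ℝ X) (a b : ℝ) :
    IntegrableOn (fun s => j (F s)) (Icc a b) := by
  have := (F.map j).integrable_of_isFiniteMeasure (μ := volume.restrict (Icc a b))
  exact this

theorem tendsto_map_simpleIntegral [CompleteSpace B] (hj : IsConeEmbedding P j)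
    (hP : IsConvexifying P) {a b : ℝ} (hab : a ≤ b) {φ : ℝ → X} (hφ : ContinuousOn φ (Icc a b))
    {F : ℕ → SimpleFunc ℝ X} (hF : TendstoUniformlyOn (fun n t => F n t) φ atTop (Icc a b)) :
    Tendsto (fun n => j (simpleIntegral P (F n) a b)) atTop (𝓝 (∫ s in a..b, j (φ s))) := by
  have hjφ : IntegrableOn (fun s => j (φ s)) (Icc a b) :=
    ((hj.continuous hP).comp_continuousOn hφ).integrableOn_Icc
  rw [Metric.tendsto_atTop]
  intro ε hε
  -- The summand `1` covers the degenerate interval and makes the final inequality strict.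
  have hδ : 0 < ε / (b - a + 1) := div_pos hε (by linarith)
  obtain ⟨N, hN⟩ := eventually_atTop.1 (Metric.tendstoUniformlyOn_iff.1 hF _ hδ)
  refine ⟨N, fun n hn => ?_⟩
  rw [hj.map_simpleIntegral hP, intervalIntegral.integral_of_le hab, ← integral_Icc_eq_integral_Ioc,
    dist_eq_norm, ← integral_sub (integrableOn_simpleFunc j _ _ _) hjφ]
  have hb := norm_setIntegral_le_of_norm_le_const (μ := volume) (s := Icc a b)
    (f := fun s => j (F n s) - j (φ s)) (C := ε / (b - a + 1)) (by simp) (fun s hs => by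
      rw [hj.norm_sub]
      refine (hP.dist_le _ _).trans ?_
      rw [dist_comm]
      exact (hN n hn s hs).le)
  refine hb.trans_lt ?_
  rw [measureReal_def, Real.volume_Icc, ENNReal.toReal_ofReal (by linarith), div_mul_eq_mul_div,
    div_lt_iff₀ (by linarith)]
  nlinarith

end IsConeEmbedding

theorem HasLIntegral.convexifying_eq {X : Type*} [LSpace X] {P : X → X} (hP : IsConvexifying P)
    {φ : ℝ → X} {a b : ℝ} {J : X} (h : HasLIntegral P φ a b J) : P J = J := by
  obtain ⟨F, -, hF⟩ := h
  have h1 : Tendsto (fun n => P (simpleIntegral P (F n) a b)) atTop (𝓝 (P J)) :=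
    (hP.continuous.tendsto J).comp hF
  simp only [IsConeEmbedding.convexifying_simpleIntegral hP] at h1
  exact tendsto_nhds_unique h1 hF

theorem HasLIntegral.map_eq {X : Type*} [LSpace X] {P : X → X} {B : Type*} [NormedAddCommGroup B]
    [NormedSpace ℝ B] [CompleteSpace B] {j : X → B} (hj : IsConeEmbedding P j)
    (hP : IsConvexifying P) {φ : ℝ → X} {a b : ℝ} (hab : a ≤ b) (hφ : ContinuousOn φ (Icc a b))
    {J : X} (h : HasLIntegral P φ a b J) : j J = ∫ s in a..b, j (φ s) := by
  obtain ⟨F, hF, hJ⟩ := h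
  exact tendsto_nhds_unique (((hj.continuous hP).tendsto J).comp hJ)
    (hj.tendsto_map_simpleIntegral hP hab hφ hF)

/-! ### Moduli of continuity. -/

namespace IsModulus

variable {ω : ℝ → ℝ} (hω : IsModulus ω)
include hω

theorem nonneg {s : ℝ} (hs : 0 ≤ s) : 0 ≤ ω s := by
  rw [← hω.map_zero]
  exact hω.monotoneOn self_mem_Ici hs hs

theorem map_natCast_mul_le (n : ℕ) {s : ℝ} (hs : 0 ≤ s) : ω (n * s) ≤ n * ω s := by
  induction n with
  | zero => simp [hω.map_zero]
  | succ n ih =>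
    have h := hω.subadditive (n * s) s (by positivity) hs
    push_cast
    rw [add_mul, one_mul]
    linarith

/-- A zero at some `s > 0` would spread to all multiples `n s` by subadditivity, and to everything
below them by monotonicity. -/
theorem pos (h0 : ∃ s, 0 ≤ s ∧ ω s ≠ 0) {s : ℝ} (hs : 0 < s) : 0 < ω s := by
  obtain ⟨r, hr, hr0⟩ := h0
  by_contra! h
  obtain ⟨n, hn⟩ := exists_nat_ge (r / s)
  have h1 : r ≤ n * s := (div_le_iff₀ hs).1 hn
  have h2 := hω.monotoneOn (mem_Ici.2 hr) (mem_Ici.2 (hr.trans h1)) h1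
  have h3 := hω.map_natCast_mul_le n hs.le
  have h4 : (n : ℝ) * ω s ≤ 0 := mul_nonpos_of_nonneg_of_nonpos (by positivity) h
  exact hr0 (le_antisymm (by linarith) (hω.nonneg hr))

theorem continuous_comp {g : ℝ → ℝ} (hg : Continuous g) (h0 : ∀ s, 0 ≤ g s) :
    Continuous fun s => ω (g s) :=
  hω.continuousOn.comp_continuous hg h0

/-- By subadditivity `ω` belongs to its own class, which makes functions built from it admissible as
extremal densities. -/
theorem abs_sub_le {s t : ℝ} (hs : 0 ≤ s) (ht : 0 ≤ t) : |ω s - ω t| ≤ ω |s - t| := by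
  wlog h : t ≤ s generalizing s t
  · rw [abs_sub_comm, abs_sub_comm s]
    exact this ht hs (by linarith)
  rw [abs_of_nonneg (sub_nonneg.2 h),
    abs_of_nonneg (sub_nonneg.2 (hω.monotoneOn (mem_Ici.2 ht) (mem_Ici.2 hs) h))]
  have := hω.subadditive t (s - t) ht (by linarith)
  rw [add_sub_cancel] at this
  linarith

theorem continuousOn_of_memH {X : Type*} [LSpace X] {a b : ℝ} {φ : ℝ → X} (h : MemH ω a b φ) :
    ContinuousOn φ (Icc a b) := by
  intro s hs
  rw [ContinuousWithinAt, tendsto_iff_dist_tendsto_zero]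
  have hc : Continuous fun t : ℝ => ω |t - s| :=
    hω.continuous_comp (by fun_prop) (fun _ => abs_nonneg _)
  have h0 : Tendsto (fun t : ℝ => ω |t - s|) (𝓝[Icc a b] s) (𝓝 0) := by
    have := hc.tendsto s
    simp only [sub_self, abs_zero, hω.map_zero] at this
    exact this.mono_left nhdsWithin_le_nhds
  refine squeeze_zero' (Eventually.of_forall fun _ => dist_nonneg) ?_ h0
  filter_upwards [self_mem_nhdsWithin] with t ht using h t ht s hs

end IsModulus

/-! ### Hukuhara differences and derivatives of primitives. -/

theorem IsIsotropic.hukuharaDiff_eq {X : Type*} [LSpace X] (hX : IsIsotropic X) {x y z : X}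
    (h : x = y + z) : hukuharaDiff x y = z := by
  have hex : ∃ z, IsHukuharaDiff x y z := ⟨z, h⟩
  rw [hukuharaDiff, dif_pos hex]
  have hs : x = y + hex.choose := hex.choose_spec
  refine hX.add_right_cancel (z := y) ?_
  rw [add_comm _ y, ← hs, h, add_comm]

theorem hukuharaDeriv_eq {X : Type*} [LSpace X] {a b : ℝ} (hab : a < b) {f : ℝ → X} {t : ℝ}
    (ht : t ∈ Icc a b) {d : X} (h : HasHukuharaDeriv a b f t d) : hukuharaDeriv a b f t = d := by
  have hex : ∃ d, HasHukuharaDeriv a b f t d := ⟨d, h⟩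
  rw [hukuharaDeriv, dif_pos hex]
  have hs : HasHukuharaDeriv a b f t hex.choose := hex.choose_spec
  -- Since `a < b`, at least one one-sided limit is required at `t`, and it determines the
  -- derivative.
  rcases ht.2.lt_or_eq with hb | hb
  · exact tendsto_nhds_unique (hs.1 hb).2 (h.1 hb).2
  · have ha : a < t := hb ▸ hab
    exact tendsto_nhds_unique (hs.2 ha).2 (h.2 ha).2

/-- On `[a, b]` the function `f` has convex values, and its increments are the integrals, in the
embedding `j`, of the function `g` with convex values. -/
structure IsHukuharaPrimitive {X : Type*} [LSpace X] {B : Type*} [NormedAddCommGroup B]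
    [NormedSpace ℝ B] (P : X → X) (j : X → B) (a b : ℝ) (f g : ℝ → X) : Prop where
  convexifying_eq : ∀ s ∈ Icc a b, P (f s) = f s
  convexifying_density : ∀ s, P (g s) = g s
  continuousOn : ContinuousOn (fun s => j (g s)) (Icc a b)
  increment : ∀ s ∈ Icc a b, ∀ s' ∈ Icc a b, s ≤ s' →
    ∃ z, P z = z ∧ f s' = f s + z ∧ j z = ∫ r in s..s', j (g r)

namespace IsHukuharaPrimitive

variable {X : Type*} [LSpace X] {P : X → X} {B : Type*} [NormedAddCommGroup B] [NormedSpace ℝ B]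
  {j : X → B} {a b : ℝ} {f g : ℝ → X}

theorem map_dividedDiff (h : IsHukuharaPrimitive P j a b f g) (hX : IsIsotropic X)
    (hP : IsConvexifying P) (hj : IsConeEmbedding P j) {s s' : ℝ} (hs : s ∈ Icc a b)
    (hs' : s' ∈ Icc a b) {c : ℝ} (hc : 0 ≤ c) (hle : s ≤ s') :
    P (c • hukuharaDiff (f s') (f s)) = c • hukuharaDiff (f s') (f s) ∧
      j (c • hukuharaDiff (f s') (f s)) = c • ∫ r in s..s', j (g r) := by
  obtain ⟨z, hz, hfz, hjz⟩ := h.increment s hs s' hs' hle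
  rw [hX.hukuharaDiff_eq hfz, hP.map_smul, hz, hj.map_smul _ _ hc, hjz]
  exact ⟨rfl, rfl⟩

theorem map_sub_map (h : IsHukuharaPrimitive P j a b f g) (hj : IsConeEmbedding P j) {s s' : ℝ}
    (hs : s ∈ Icc a b) (hs' : s' ∈ Icc a b) (hle : s ≤ s') :
    j (f s') - j (f s) = ∫ r in s..s', j (g r) := by
  obtain ⟨z, -, hfz, hjz⟩ := h.increment s hs s' hs' hle
  rw [hfz, hj.map_add, hjz, add_sub_cancel_left]

/-- The difference quotients and `g t` are fixed by `P`, where `j` is isometric, so their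
convergence is the fundamental theorem of calculus in `B`. -/
theorem hasHukuharaDeriv [CompleteSpace B] (h : IsHukuharaPrimitive P j a b f g)
    (hab : a < b) (hX : IsIsotropic X) (hP : IsConvexifying P) (hj : IsConeEmbedding P j) {t : ℝ}
    (ht : t ∈ Icc a b) : HasHukuharaDeriv a b f t (g t) := by
  -- Extension by constants gives a function continuous on the whole line, whose primitive has a
  -- two-sided derivative even at `a` and `b`.
  set G : ℝ → B := IccExtend hab.le ((Icc a b).domRestrict fun s => j (g s)) with hG
  have hGc : Continuous G := h.continuousOn.domRestrict.Icc_extend'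
  have hGeq : ∀ s ∈ Icc a b, G s = j (g s) := fun s hs => IccExtend_of_mem hab.le _ hs
  have hint : ∀ s ∈ Icc a b, ∀ s' ∈ Icc a b, s ≤ s' →
      ∫ r in s..s', j (g r) = (∫ r in a..s', G r) - ∫ r in a..s, G r := by
    intro s hs s' hs' hle
    rw [intervalIntegral.integral_interval_sub_left (hGc.intervalIntegrable _ _)
      (hGc.intervalIntegrable _ _)]
    refine intervalIntegral.integral_congr fun r hr => ?_
    rw [uIcc_of_le hle] at hr
    exact (hGeq r ⟨hs.1.trans hr.1, hr.2.trans hs'.2⟩).symm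
  have hder : HasDerivAt (fun s => ∫ r in a..s, G r) (j (g t)) t := by
    rw [← hGeq t ht]
    exact intervalIntegral.integral_hasDerivAt_right (hGc.intervalIntegrable _ _)
      (hGc.stronglyMeasurableAtFilter _ _) hGc.continuousAt
  have hslope := hasDerivAt_iff_tendsto_slope_zero.1 hder
  refine ⟨fun hb => ?_, fun ha => ?_⟩
  · have hev : ∀ᶠ γ in 𝓝[>] (0 : ℝ), γ ∈ Ioo 0 (b - t) := Ioo_mem_nhdsGT (by linarith)
    have hmem : ∀ γ ∈ Ioo 0 (b - t), t + γ ∈ Icc a b := fun γ hγ =>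
      ⟨by linarith [ht.1, hγ.1], by linarith [hγ.2]⟩
    refine ⟨?_, ?_⟩
    · filter_upwards [hev] with γ hγ
      obtain ⟨z, -, hz, -⟩ := h.increment t ht _ (hmem γ hγ) (by linarith [hγ.1])
      exact ⟨z, hz⟩
    · rw [tendsto_iff_dist_tendsto_zero]
      have h1 := tendsto_iff_norm_sub_tendsto_zero.1
        (hslope.mono_left (nhdsWithin_mono 0 fun γ hγ => ne_of_gt hγ))
      refine h1.congr' ?_
      filter_upwards [hev] with γ hγ
      have hle : t ≤ t + γ := by linarith [hγ.1]
      obtain ⟨hp, hv⟩ := h.map_dividedDiff hX hP hj ht (hmem γ hγ) (inv_nonneg.2 hγ.1.le) hle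
      rw [hj.dist_eq hp (h.convexifying_density t), hv, hint t ht _ (hmem γ hγ) hle]
  · have hev : ∀ᶠ γ in 𝓝[>] (0 : ℝ), γ ∈ Ioo 0 (t - a) := Ioo_mem_nhdsGT (by linarith)
    have hmem : ∀ γ ∈ Ioo 0 (t - a), t - γ ∈ Icc a b := fun γ hγ =>
      ⟨by linarith [hγ.2], by linarith [ht.2, hγ.1]⟩
    refine ⟨?_, ?_⟩
    · filter_upwards [hev] with γ hγ
      obtain ⟨z, -, hz, -⟩ := h.increment _ (hmem γ hγ) t ht (by linarith [hγ.1])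
      exact ⟨z, hz⟩
    · rw [tendsto_iff_dist_tendsto_zero]
      have hneg : Tendsto (fun γ : ℝ => -γ) (𝓝[>] 0) (𝓝[≠] 0) := by
        refine tendsto_nhdsWithin_of_tendsto_nhds_of_eventually_within _ ?_ ?_
        · have : Tendsto (fun γ : ℝ => -γ) (𝓝 0) (𝓝 0) := by
            simpa using (continuous_neg (G := ℝ)).tendsto 0
          exact this.mono_left nhdsWithin_le_nhds
        · filter_upwards [self_mem_nhdsWithin] with γ hγ
          exact neg_ne_zero.2 (ne_of_gt hγ)
      have h1 := tendsto_iff_norm_sub_tendsto_zero.1 (hslope.comp hneg)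
      refine h1.congr' ?_
      filter_upwards [hev] with γ hγ
      have hle : t - γ ≤ t := by linarith [hγ.1]
      obtain ⟨hp, hv⟩ := h.map_dividedDiff hX hP hj (hmem γ hγ) ht (inv_nonneg.2 hγ.1.le) hle
      rw [hj.dist_eq hp (h.convexifying_density t), hv, hint _ (hmem γ hγ) t ht hle,
        Function.comp_apply, inv_neg, neg_smul, ← smul_neg, neg_sub, ← sub_eq_add_neg]

theorem hukuharaDeriv_eq [CompleteSpace B] (h : IsHukuharaPrimitive P j a b f g)
    (hab : a < b) (hX : IsIsotropic X) (hP : IsConvexifying P) (hj : IsConeEmbedding P j) {t : ℝ}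
    (ht : t ∈ Icc a b) : hukuharaDeriv a b f t = g t :=
  _root_.hukuharaDeriv_eq hab ht (h.hasHukuharaDeriv hab hX hP hj ht)

theorem bddAbove_normValues (h : IsHukuharaPrimitive P j a b f g)
    (hab : a < b) (hP : IsConvexifying P) (hj : IsConeEmbedding P j) :
    BddAbove (normValues a b f) := by
  obtain ⟨C, hC⟩ := isCompact_Icc.exists_bound_of_continuousOn h.continuousOn
  have ha : a ∈ Icc a b := left_mem_Icc.2 hab.le
  have hC0 : 0 ≤ C := (norm_nonneg _).trans (hC a ha)
  refine ⟨‖j (f a)‖ + C * (b - a), ?_⟩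
  rintro _ ⟨t, ht, rfl⟩
  rw [hj.normL_eq hP (h.convexifying_eq t ht)]
  have h1 := h.map_sub_map hj ha ht ht.1
  have h2 : ‖∫ r in a..t, j (g r)‖ ≤ C * |t - a| := by
    refine intervalIntegral.norm_integral_le_of_norm_le_const fun r hr => hC r ?_
    rw [uIoc_of_le ht.1] at hr
    exact ⟨hr.1.le, hr.2.trans ht.2⟩
  rw [abs_of_nonneg (by linarith [ht.1])] at h2
  have h3 : C * (t - a) ≤ C * (b - a) := mul_le_mul_of_nonneg_left (by linarith [ht.2]) hC0
  have h4 : j (f t) = j (f a) + ∫ r in a..t, j (g r) := by rw [← h1]; abel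
  rw [h4]
  exact (norm_add_le _ _).trans (by linarith)

/-- The integral is an increment of `j ∘ f`; bounding its two end values separately is the origin of
the factor `2` in both inequalities. -/
theorem norm_integral_le (h : IsHukuharaPrimitive P j a b f g)
    (hab : a < b) (hP : IsConvexifying P) (hj : IsConeEmbedding P j) {s s' : ℝ}
    (hs : s ∈ Icc a b) (hs' : s' ∈ Icc a b) (hle : s ≤ s') :
    ‖∫ r in s..s', j (g r)‖ ≤ 2 * normC a b f := by
  have hbd := h.bddAbove_normValues hab hP hj
  have key : ∀ t ∈ Icc a b, ‖j (f t)‖ ≤ normC a b f := fun t ht => by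
    rw [← hj.normL_eq hP (h.convexifying_eq t ht)]
    exact le_csSup hbd ⟨t, ht, rfl⟩
  rw [← h.map_sub_map hj hs hs' hle]
  linarith [norm_sub_le (j (f s')) (j (f s)), key s hs, key s' hs']

end IsHukuharaPrimitive

/-- The density is `P (k • φ)`, since `φ` itself need not have convex values. Passing to `P` does
not change images under `j` and does not increase distances. -/
theorem MemWBar.exists_isHukuharaPrimitive {X : Type*} [LSpace X] {P : X → X} {B : Type*}
    [NormedAddCommGroup B] [NormedSpace ℝ B] [CompleteSpace B] {j : X → B} {a b : ℝ} {f : ℝ → X}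
    {ω : ℝ → ℝ} (h : MemWBar P ω a b f) (hω : IsModulus ω)
    (hP : IsConvexifying P) (hj : IsConeEmbedding P j) :
    ∃ k g, IsHukuharaPrimitive P j a b f g ∧
      ∀ s ∈ Icc a b, ∀ s' ∈ Icc a b, dist (g s) (g s') ≤ k * ω |s - s'| := by
  obtain ⟨k, hk, f₀, ⟨φ, hφ, x, hx, hf₀⟩, hf⟩ := h
  have hφc := hω.continuousOn_of_memH hφ
  have hjc : ContinuousOn (fun s => j (φ s)) (Icc a b) :=
    (hj.continuous hP).comp_continuousOn hφc
  have hjg : ∀ s, j (P (k • φ s)) = k • j (φ s) := fun s => by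
    rw [hj.map_convexifying hP, hj.map_smul _ _ hk.le]
  have hjf : ∀ s ∈ Icc a b, P (f s) = f s ∧ j (f s) = k • (j x + ∫ r in a..s, j (φ r)) := by
    intro s hs
    obtain ⟨J, hJ, hfJ⟩ := hf₀ s hs
    rw [hf s hs, hfJ, hP.map_smul, hP.map_add, hP.map_eq_self hx, hJ.convexifying_eq hP,
      hj.map_smul _ _ hk.le, hj.map_add,
      hJ.map_eq hj hP hs.1 (hφc.mono (Icc_subset_Icc_right hs.2))]
    exact ⟨rfl, rfl⟩
  have hgc : ContinuousOn (fun s => j (P (k • φ s))) (Icc a b) := by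
    simp only [hjg]
    exact hjc.const_smul k
  refine ⟨k, fun s => P (k • φ s), ⟨fun s hs => (hjf s hs).1, fun s => hP.idem _, hgc, ?_⟩, ?_⟩
  · intro s hs s' hs' hle
    obtain ⟨z, hz, hjz⟩ := hj.exists_map_eq_integral hP hle
      (hgc.mono (Icc_subset_Icc hs.1 hs'.2))
    -- The integral over `[s, s']` lies in the embedded cone, so it comes from an element `z` of
    -- `X`; this element is the Hukuhara difference.
    refine ⟨z, hz, hj.eq_of_map_eq (hjf s' hs').1 ?_ ?_, hjz⟩
    · rw [hP.map_add, hz, (hjf s hs).1]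
    · rw [hj.map_add, hjz, (hjf s hs).2, (hjf s' hs').2]
      have hi : ∀ r ∈ Icc a b, IntervalIntegrable (fun s => j (φ s)) volume a r := fun r hr =>
        (hjc.mono (by rw [uIcc_of_le hr.1]; exact Icc_subset_Icc_right hr.2)).intervalIntegrable
      simp only [hjg]
      rw [intervalIntegral.integral_smul, ← intervalIntegral.integral_interval_sub_left (hi s' hs')
        (hi s hs), ← smul_add]
      congr 1
      abel
  · intro s hs s' hs'
    refine (hP.dist_le _ _).trans ?_
    rw [LSpace.dist_smul_lspace, abs_of_pos hk]
    exact mul_le_mul_of_nonneg_left (hφ s hs s' hs') hk.le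

/-! ### Means over nested intervals and their estimates. -/

section Averages

variable {B : Type*} [NormedAddCommGroup B] [NormedSpace ℝ B]

/-- Let `r` be the ratio of the length of `[m, n]` to the total length of the gaps `[A, m]` and `[n,
D]`. Each gap is reflected in its inner end and scaled by `r`; the two images tile `[m, n]`, meeting
at one point. As `(n - m)⁻¹ - (D - A)⁻¹ = (D - A)⁻¹ r⁻¹`, the weights agree with this change of
variables. Paired points are `(1 + r) u` apart. -/
theorem average_sub_average {G : ℝ → B} (hG : Continuous G) {A m n D : ℝ} (hmn : m < n)
    (hAD : n - m < D - A) :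
    (n - m)⁻¹ • (∫ s in m..n, G s) - (D - A)⁻¹ • (∫ s in A..D, G s) =
      (D - A)⁻¹ • ((∫ u in (0 : ℝ)..(m - A),
          (G (m + (n - m) / ((m - A) + (D - n)) * u) - G (m - u))) +
        ∫ u in (0 : ℝ)..(D - n),
          (G (n - (n - m) / ((m - A) + (D - n)) * u) - G (n + u))) := by
  have hw : 0 < (m - A) + (D - n) := by linarith
  have hγ : 0 < n - m := by linarith
  set r := (n - m) / ((m - A) + (D - n)) with hr
  have hr0 : r ≠ 0 := (div_pos hγ hw).ne'
  have hi : ∀ x y, IntervalIntegrable G volume x y := fun x y => hG.intervalIntegrable x y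
  have hc : n - r * (D - n) = m + r * (m - A) := by
    rw [hr]; field_simp; ring
  rw [intervalIntegral.integral_sub (Continuous.intervalIntegrable (by fun_prop) _ _)
      (Continuous.intervalIntegrable (by fun_prop) _ _),
    intervalIntegral.integral_sub (Continuous.intervalIntegrable (by fun_prop) _ _)
      (Continuous.intervalIntegrable (by fun_prop) _ _),
    intervalIntegral.integral_comp_add_mul G hr0, intervalIntegral.integral_comp_sub_mul G hr0,
    intervalIntegral.integral_comp_sub_left G, intervalIntegral.integral_comp_add_left G]
  simp only [mul_zero, add_zero, sub_zero, sub_sub_cancel, add_sub_cancel, hc]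
  rw [← intervalIntegral.integral_add_adjacent_intervals (hi A m) (hi m D),
    ← intervalIntegral.integral_add_adjacent_intervals (hi m n) (hi n D),
    ← intervalIntegral.integral_add_adjacent_intervals (hi m (m + r * (m - A)))
      (hi (m + r * (m - A)) n)]
  have h1 : (n - m)⁻¹ = (D - A)⁻¹ * r⁻¹ + (D - A)⁻¹ := by
    have : D - A ≠ 0 := by linarith
    rw [hr]; field_simp; ring
  rw [h1]
  module

theorem sub_average [CompleteSpace B] {G : ℝ → B} (hG : Continuous G) {A t D : ℝ} (hAD : A < D) :
    G t - (D - A)⁻¹ • (∫ s in A..D, G s) =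
      (D - A)⁻¹ • ((∫ u in (0 : ℝ)..(t - A), (G t - G (t - u))) +
        ∫ u in (0 : ℝ)..(D - t), (G t - G (t + u))) := by
  have hi : ∀ x y, IntervalIntegrable G volume x y := fun x y => hG.intervalIntegrable x y
  rw [intervalIntegral.integral_sub (Continuous.intervalIntegrable (by fun_prop) _ _)
      (Continuous.intervalIntegrable (by fun_prop) _ _),
    intervalIntegral.integral_sub (Continuous.intervalIntegrable (by fun_prop) _ _)
      (Continuous.intervalIntegrable (by fun_prop) _ _),
    intervalIntegral.integral_comp_sub_left G, intervalIntegral.integral_comp_add_left G,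
    intervalIntegral.integral_const, intervalIntegral.integral_const]
  simp only [add_zero, sub_zero, sub_sub_cancel, add_sub_cancel]
  rw [← intervalIntegral.integral_add_adjacent_intervals (hi A t) (hi t D)]
  have h1 : G t = (D - A)⁻¹ • (D - A) • G t := by
    rw [smul_smul, inv_mul_cancel₀ (by linarith), one_smul]
  nth_rw 1 [h1]
  module

end Averages

/-- A linear substitution puts `K` in the form produced by the pairing in `average_sub_average`. -/
theorem landauK_eq (ω : ℝ → ℝ) {γ₁ γ₂ h₁ h₂ : ℝ} (hh : 0 < h₁ + h₂)
    (hlt : γ₁ + γ₂ < h₁ + h₂) :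
    landauK ω γ₁ γ₂ h₁ h₂ = (h₁ + h₂)⁻¹ *
      ((∫ u in (0 : ℝ)..(h₁ - γ₁), ω ((h₁ + h₂) / ((h₁ - γ₁) + (h₂ - γ₂)) * u)) +
        ∫ u in (0 : ℝ)..(h₂ - γ₂), ω ((h₁ + h₂) / ((h₁ - γ₁) + (h₂ - γ₂)) * u)) := by
  have hw : 0 < (h₁ - γ₁) + (h₂ - γ₂) := by linarith
  set w := (h₁ - γ₁) + (h₂ - γ₂) with hwdef
  have hk : (h₁ + h₂) / w ≠ 0 := (div_pos hh hw).ne'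
  rw [intervalIntegral.integral_comp_mul_left _ hk, intervalIntegral.integral_comp_mul_left _ hk,
    landauK, modulusIntegral, modulusIntegral, ← hwdef, mul_zero, div_mul_eq_mul_div,
    div_mul_eq_mul_div, smul_eq_mul, smul_eq_mul]
  field_simp

namespace IsModulus

variable {ω : ℝ → ℝ} (hω : IsModulus ω)
include hω

theorem intervalIntegrable_mul {κ : ℝ} (hκ : 0 ≤ κ) {u : ℝ} (hu : 0 ≤ u) :
    IntervalIntegrable (fun v => ω (κ * v)) volume 0 u := by
  refine ContinuousOn.intervalIntegrable (hω.continuousOn.comp (by fun_prop) fun v hv => ?_)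
  rw [uIcc_of_le hu] at hv
  exact mul_nonneg hκ hv.1

theorem norm_integral_le {B : Type*} [NormedAddCommGroup B] [NormedSpace ℝ B] {F : ℝ → B}
    {κ M u : ℝ} (hκ : 0 ≤ κ) (hu : 0 ≤ u) (hF : ∀ v, 0 ≤ v → v ≤ u → ‖F v‖ ≤ M * ω (κ * v)) :
    ‖∫ v in (0 : ℝ)..u, F v‖ ≤ M * ∫ v in (0 : ℝ)..u, ω (κ * v) := by
  rw [← intervalIntegral.integral_const_mul]
  exact intervalIntegral.norm_integral_le_of_norm_le hu
    (Eventually.of_forall fun v hv => hF v hv.1.le hv.2)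
    ((hω.intervalIntegrable_mul hκ hu).const_mul M)

theorem norm_average_sub_average_le {B : Type*} [NormedAddCommGroup B] [NormedSpace ℝ B]
    {G : ℝ → B} (hG : Continuous G) {t γ₁ γ₂ h₁ h₂ M : ℝ} (h1 : γ₁ ≤ h₁) (h2 : γ₂ ≤ h₂)
    (hγ : 0 < γ₁ + γ₂)
    (hM : ∀ s ∈ Icc (t - h₁) (t + h₂), ∀ s' ∈ Icc (t - h₁) (t + h₂),
      ‖G s - G s'‖ ≤ M * ω |s - s'|) :
    ‖(γ₁ + γ₂)⁻¹ • (∫ s in (t - γ₁)..(t + γ₂), G s) -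
        (h₁ + h₂)⁻¹ • (∫ s in (t - h₁)..(t + h₂), G s)‖ ≤ landauK ω γ₁ γ₂ h₁ h₂ * M := by
  -- When the intervals coincide the pairing ratio is undefined, but the means agree and the leading
  -- factor of `landauK` is zero.
  rcases (add_le_add h1 h2).eq_or_lt with heq | hlt
  · obtain rfl : γ₁ = h₁ := by linarith
    obtain rfl : γ₂ = h₂ := by linarith
    simp [landauK]
  have hw : 0 < (h₁ - γ₁) + (h₂ - γ₂) := by linarith
  have hh : 0 < h₁ + h₂ := by linarith
  have e1 : t + γ₂ - (t - γ₁) = γ₁ + γ₂ := by ring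
  have e2 : t + h₂ - (t - h₁) = h₁ + h₂ := by ring
  have e3 : t - γ₁ - (t - h₁) = h₁ - γ₁ := by ring
  have e4 : t + h₂ - (t + γ₂) = h₂ - γ₂ := by ring
  have h := average_sub_average hG (A := t - h₁) (m := t - γ₁) (n := t + γ₂) (D := t + h₂)
    (by linarith) (by linarith)
  rw [e1, e2, e3, e4] at h
  rw [h, norm_smul, norm_inv, Real.norm_of_nonneg hh.le, landauK_eq ω hh hlt, mul_assoc]
  refine mul_le_mul_of_nonneg_left ?_ (inv_nonneg.2 hh.le)
  set w := (h₁ - γ₁) + (h₂ - γ₂) with hwdef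
  have hr : 0 < (γ₁ + γ₂) / w := div_pos hγ hw
  -- Paired points lie on opposite sides of an end of the inner interval, at distances `r u` and `u`
  -- from it, where `r = (γ₁ + γ₂) / w`.
  have hκ : (h₁ + h₂) / w = (γ₁ + γ₂) / w + 1 := by
    rw [div_add_one hw.ne']; congr 1; rw [hwdef]; ring
  have hrw : (γ₁ + γ₂) / w * w = γ₁ + γ₂ := div_mul_cancel₀ _ hw.ne'
  have hκ0 : 0 ≤ (h₁ + h₂) / w := (div_pos hh hw).le
  have hru : ∀ u, u ≤ w → (γ₁ + γ₂) / w * u ≤ γ₁ + γ₂ := fun u hu =>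
    (mul_le_mul_of_nonneg_left hu hr.le).trans hrw.le
  have hbound : ∀ s s' u : ℝ, s ∈ Icc (t - h₁) (t + h₂) → s' ∈ Icc (t - h₁) (t + h₂) →
      |s - s'| = (h₁ + h₂) / w * u → ‖G s - G s'‖ ≤ M * ω ((h₁ + h₂) / w * u) :=
    fun s s' u hs hs' he => he ▸ hM s hs s' hs'
  refine (norm_add_le _ _).trans ?_
  rw [add_mul, mul_comm _ M, mul_comm _ M]
  refine add_le_add (hω.norm_integral_le hκ0 (by linarith) fun u hu hu' => ?_)
    (hω.norm_integral_le hκ0 (by linarith) fun u hu hu' => ?_)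
  · have hp : 0 ≤ (γ₁ + γ₂) / w * u := by positivity
    have := hru u (by linarith)
    refine hbound _ _ _ ⟨by linarith, by linarith⟩ ⟨by linarith, by linarith⟩ ?_
    rw [hκ, abs_of_nonneg (by linarith)]
    ring
  · have hp : 0 ≤ (γ₁ + γ₂) / w * u := by positivity
    have := hru u (by linarith)
    refine hbound _ _ _ ⟨by linarith, by linarith⟩ ⟨by linarith, by linarith⟩ ?_
    rw [hκ, abs_of_nonpos (by linarith)]
    ring

theorem norm_sub_average_le {B : Type*} [NormedAddCommGroup B] [NormedSpace ℝ B]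
    [CompleteSpace B]
    {G : ℝ → B} (hG : Continuous G) {t h₁ h₂ M : ℝ} (h1 : 0 ≤ h₁) (h2 : 0 ≤ h₂)
    (hh : 0 < h₁ + h₂)
    (hM : ∀ s ∈ Icc (t - h₁) (t + h₂), ∀ s' ∈ Icc (t - h₁) (t + h₂),
      ‖G s - G s'‖ ≤ M * ω |s - s'|) :
    ‖G t - (h₁ + h₂)⁻¹ • (∫ s in (t - h₁)..(t + h₂), G s)‖ ≤
      (modulusIntegral ω h₁ + modulusIntegral ω h₂) / (h₁ + h₂) * M := by
  have e2 : t + h₂ - (t - h₁) = h₁ + h₂ := by ring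
  have h := sub_average hG (A := t - h₁) (t := t) (D := t + h₂) (by linarith)
  rw [e2, sub_sub_cancel, add_sub_cancel_left] at h
  rw [h, norm_smul, norm_inv, Real.norm_of_nonneg hh.le, div_eq_inv_mul, mul_assoc]
  refine mul_le_mul_of_nonneg_left ?_ (inv_nonneg.2 hh.le)
  refine (norm_add_le _ _).trans ?_
  rw [add_mul, mul_comm _ M, mul_comm _ M, modulusIntegral, modulusIntegral]
  have hb := fun (u : ℝ) (hu : 0 ≤ u) (F : ℝ → B)
      (hF : ∀ v, 0 ≤ v → v ≤ u → ‖F v‖ ≤ M * ω (1 * v)) =>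
    hω.norm_integral_le zero_le_one hu hF
  simp only [one_mul] at hb
  have ht : t ∈ Icc (t - h₁) (t + h₂) := ⟨by linarith, by linarith⟩
  refine add_le_add (hb _ h1 _ fun v hv hv' => ?_) (hb _ h2 _ fun v hv hv' => ?_)
  · have := hM t ht (t - v) ⟨by linarith, by linarith⟩
    rwa [sub_sub_cancel, abs_of_nonneg hv] at this
  · have := hM t ht (t + v) ⟨by linarith, by linarith⟩
    rwa [sub_add_cancel_left, abs_neg, abs_of_nonneg hv] at this

end IsModulus

/-! ### The two inequalities for primitives. -/

namespace IsHukuharaPrimitive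

variable {X : Type*} [LSpace X] {P : X → X} {B : Type*} [NormedAddCommGroup B] [NormedSpace ℝ B]
  {j : X → B} {a b : ℝ} {f g : ℝ → X}

theorem bddAbove_omegaQuotients [CompleteSpace B] (h : IsHukuharaPrimitive P j a b f g)
    (hab : a < b) (hX : IsIsotropic X) (hP : IsConvexifying P) (hj : IsConeEmbedding P j)
    {ω : ℝ → ℝ} (hω : IsModulus ω) (hω0 : ∃ s, 0 ≤ s ∧ ω s ≠ 0) {k : ℝ}
    (hk : ∀ s ∈ Icc a b, ∀ s' ∈ Icc a b, dist (g s) (g s') ≤ k * ω |s - s'|) :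
    BddAbove (omegaQuotients ω a b (hukuharaDeriv a b f)) := by
  refine ⟨k, ?_⟩
  rintro _ ⟨s, hs, s', hs', hne, rfl⟩
  rw [h.hukuharaDeriv_eq hab hX hP hj hs, h.hukuharaDeriv_eq hab hX hP hj hs',
    div_le_iff₀ (hω.pos hω0 (abs_pos.2 (sub_ne_zero.2 hne)))]
  exact hk s hs s' hs'

theorem norm_sub_le_normOmega [CompleteSpace B] (h : IsHukuharaPrimitive P j a b f g)
    (hab : a < b) (hX : IsIsotropic X) (hP : IsConvexifying P) (hj : IsConeEmbedding P j)
    {ω : ℝ → ℝ} (hω : IsModulus ω) (hω0 : ∃ s, 0 ≤ s ∧ ω s ≠ 0) {k : ℝ}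
    (hk : ∀ s ∈ Icc a b, ∀ s' ∈ Icc a b, dist (g s) (g s') ≤ k * ω |s - s'|) {s s' : ℝ}
    (hs : s ∈ Icc a b) (hs' : s' ∈ Icc a b) :
    ‖j (g s) - j (g s')‖ ≤ normOmega ω a b (hukuharaDeriv a b f) * ω |s - s'| := by
  rcases eq_or_ne s s' with rfl | hne
  · simp [hω.map_zero]
  rw [← hj.dist_eq (h.convexifying_density s) (h.convexifying_density s'),
    ← div_le_iff₀ (hω.pos hω0 (abs_pos.2 (sub_ne_zero.2 hne)))]
  refine le_csSup (h.bddAbove_omegaQuotients hab hX hP hj hω hω0 hk) ⟨s, hs, s', hs', hne, ?_⟩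
  rw [h.hukuharaDeriv_eq hab hX hP hj hs, h.hukuharaDeriv_eq hab hX hP hj hs']

theorem exists_continuous_extension (h : IsHukuharaPrimitive P j a b f g) (hab : a < b) :
    ∃ G : ℝ → B, Continuous G ∧ ∀ s ∈ Icc a b, G s = j (g s) :=
  ⟨IccExtend hab.le ((Icc a b).domRestrict fun s => j (g s)),
    h.continuousOn.domRestrict.Icc_extend', fun _ hs => IccExtend_of_mem hab.le _ hs⟩

theorem normL_dividedDiff (h : IsHukuharaPrimitive P j a b f g) (hX : IsIsotropic X)
    (hP : IsConvexifying P) (hj : IsConeEmbedding P j) {t γ₁ γ₂ : ℝ}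
    (h1 : t - γ₁ ∈ Icc a b) (h2 : t + γ₂ ∈ Icc a b) (hγ : 0 ≤ γ₁ + γ₂) :
    normL (dividedDiff γ₁ γ₂ f t) = ‖(γ₁ + γ₂)⁻¹ • ∫ r in (t - γ₁)..(t + γ₂), j (g r)‖ := by
  obtain ⟨hp, hv⟩ := h.map_dividedDiff hX hP hj h1 h2 (inv_nonneg.2 hγ) (by linarith)
  rw [dividedDiff, hj.normL_eq hP hp, hv]

theorem normL_dividedDiff_le [CompleteSpace B] (h : IsHukuharaPrimitive P j a b f g)
    (hab : a < b) (hX : IsIsotropic X) (hP : IsConvexifying P) (hj : IsConeEmbedding P j)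
    {ω : ℝ → ℝ} (hω : IsModulus ω) (hω0 : ∃ s, 0 ≤ s ∧ ω s ≠ 0) {k : ℝ}
    (hk : ∀ s ∈ Icc a b, ∀ s' ∈ Icc a b, dist (g s) (g s') ≤ k * ω |s - s'|)
    {t γ₁ γ₂ h₁ h₂ : ℝ} (h1 : γ₁ ≤ h₁) (h2 : γ₂ ≤ h₂) (hγ : 0 < γ₁ + γ₂)
    (ha : a ≤ t - h₁) (hb : t + h₂ ≤ b) :
    normL (dividedDiff γ₁ γ₂ f t) ≤
      landauK ω γ₁ γ₂ h₁ h₂ * normOmega ω a b (hukuharaDeriv a b f) +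
        2 / (h₁ + h₂) * normC a b f := by
  obtain ⟨G, hG, hGg⟩ := h.exists_continuous_extension hab
  have hh : 0 < h₁ + h₂ := by linarith
  have hsub : Icc (t - h₁) (t + h₂) ⊆ Icc a b := Icc_subset_Icc ha hb
  have hint : ∀ s ∈ Icc a b, ∀ s' ∈ Icc a b, s ≤ s' →
      ∫ r in s..s', j (g r) = ∫ r in s..s', G r := fun s hs s' hs' hle => by
    refine intervalIntegral.integral_congr fun r hr => ?_
    rw [uIcc_of_le hle] at hr
    exact (hGg r ⟨hs.1.trans hr.1, hr.2.trans hs'.2⟩).symm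
  have m1 : t - γ₁ ∈ Icc a b := hsub ⟨by linarith, by linarith⟩
  have m2 : t + γ₂ ∈ Icc a b := hsub ⟨by linarith, by linarith⟩
  have m3 : t - h₁ ∈ Icc a b := hsub ⟨by linarith, by linarith⟩
  have m4 : t + h₂ ∈ Icc a b := hsub ⟨by linarith, by linarith⟩
  rw [h.normL_dividedDiff hX hP hj m1 m2 hγ.le, hint _ m1 _ m2 (by linarith)]
  have key := hω.norm_average_sub_average_le hG (t := t) h1 h2 hγ
    (M := normOmega ω a b (hukuharaDeriv a b f)) fun s hs s' hs' => by
      rw [hGg s (hsub hs), hGg s' (hsub hs')]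
      exact h.norm_sub_le_normOmega hab hX hP hj hω hω0 hk (hsub hs) (hsub hs')
  have hC := h.norm_integral_le hab hP hj m3 m4 (by linarith)
  rw [hint _ m3 _ m4 (by linarith)] at hC
  have hC' : ‖(h₁ + h₂)⁻¹ • ∫ s in (t - h₁)..(t + h₂), G s‖ ≤ 2 / (h₁ + h₂) * normC a b f := by
    rw [norm_smul, norm_inv, Real.norm_of_nonneg hh.le, div_mul_eq_mul_div, div_eq_inv_mul]
    exact mul_le_mul_of_nonneg_left hC (inv_nonneg.2 hh.le)
  refine (norm_le_norm_sub_add _ ((h₁ + h₂)⁻¹ • ∫ s in (t - h₁)..(t + h₂), G s)).trans ?_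
  linarith

theorem normL_hukuharaDeriv_le [CompleteSpace B] (h : IsHukuharaPrimitive P j a b f g)
    (hab : a < b) (hX : IsIsotropic X) (hP : IsConvexifying P) (hj : IsConeEmbedding P j)
    {ω : ℝ → ℝ} (hω : IsModulus ω) (hω0 : ∃ s, 0 ≤ s ∧ ω s ≠ 0) {k : ℝ}
    (hk : ∀ s ∈ Icc a b, ∀ s' ∈ Icc a b, dist (g s) (g s') ≤ k * ω |s - s'|)
    {t h₁ h₂ : ℝ} (h1 : 0 ≤ h₁) (h2 : 0 ≤ h₂) (hh : 0 < h₁ + h₂)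
    (ha : a ≤ t - h₁) (hb : t + h₂ ≤ b) :
    normL (hukuharaDeriv a b f t) ≤
      (modulusIntegral ω h₁ + modulusIntegral ω h₂) / (h₁ + h₂) *
          normOmega ω a b (hukuharaDeriv a b f) +
        2 / (h₁ + h₂) * normC a b f := by
  obtain ⟨G, hG, hGg⟩ := h.exists_continuous_extension hab
  have hsub : Icc (t - h₁) (t + h₂) ⊆ Icc a b := Icc_subset_Icc ha hb
  have ht : t ∈ Icc a b := hsub ⟨by linarith, by linarith⟩
  have m3 : t - h₁ ∈ Icc a b := hsub ⟨by linarith, by linarith⟩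
  have m4 : t + h₂ ∈ Icc a b := hsub ⟨by linarith, by linarith⟩
  have hint : ∫ r in (t - h₁)..(t + h₂), j (g r) = ∫ r in (t - h₁)..(t + h₂), G r := by
    refine intervalIntegral.integral_congr fun r hr => ?_
    rw [uIcc_of_le (by linarith)] at hr
    exact (hGg r (hsub hr)).symm
  rw [h.hukuharaDeriv_eq hab hX hP hj ht, hj.normL_eq hP (h.convexifying_density t), ← hGg t ht]
  have key := hω.norm_sub_average_le hG (t := t) h1 h2 hh
    (M := normOmega ω a b (hukuharaDeriv a b f)) fun s hs s' hs' => by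
      rw [hGg s (hsub hs), hGg s' (hsub hs')]
      exact h.norm_sub_le_normOmega hab hX hP hj hω hω0 hk (hsub hs) (hsub hs')
  have hC := h.norm_integral_le hab hP hj m3 m4 (by linarith)
  rw [hint] at hC
  have hC' : ‖(h₁ + h₂)⁻¹ • ∫ s in (t - h₁)..(t + h₂), G s‖ ≤ 2 / (h₁ + h₂) * normC a b f := by
    rw [norm_smul, norm_inv, Real.norm_of_nonneg hh.le, div_mul_eq_mul_div, div_eq_inv_mul]
    exact mul_le_mul_of_nonneg_left hC (inv_nonneg.2 hh.le)
  refine (norm_le_norm_sub_add _ ((h₁ + h₂)⁻¹ • ∫ s in (t - h₁)..(t + h₂), G s)).trans ?_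
  linarith

end IsHukuharaPrimitive

/-! ### A line of convex elements, and extremal functions along it. -/

section Line

variable {X : Type*} [LSpace X]

/-- The points `r⁺ e + r⁻ e'`; a line through `e`, if `e'` is the inverse of `e`. -/
noncomputable def lineMap (e e' : X) (r : ℝ) : X :=
  (max r 0) • e + (max (-r) 0) • e'

/-- `e` is a convex element of norm `1` with the inverse `e'`. -/
structure IsUnitDirection (e e' : X) : Prop where
  convex : e ∈ convexElements X
  add_eq_zero : e + e' = 0
  dist_zero : dist e 0 = 1

theorem exists_isUnitDirection
    (hinv : invertibleElements X ∩ convexElements X ≠ {0}) : ∃ e e' : X, IsUnitDirection e e' := by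
  have h0 : (0 : X) ∈ invertibleElements X ∩ convexElements X :=
    ⟨⟨0, add_zero 0⟩, fun α β _ _ => by simp [SemilinearSpace.real_smul_zero]⟩
  obtain ⟨e, ⟨⟨e', he'⟩, hc⟩, hne⟩ : ∃ e ∈ invertibleElements X ∩ convexElements X, e ≠ 0 := by
    by_contra! h
    exact hinv (Subset.antisymm h (singleton_subset_iff.2 h0))
  have hd : 0 < dist e 0 := dist_pos.2 hne
  refine ⟨(dist e 0)⁻¹ • e, (dist e 0)⁻¹ • e', fun α β hα hβ => ?_, ?_, ?_⟩
  · rw [smul_smul, smul_smul, smul_smul, add_mul, hc _ _ (by positivity) (by positivity)]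
  · rw [← SemilinearSpace.smul_add_semilinear, he', SemilinearSpace.real_smul_zero]
  · have h := LSpace.dist_smul_lspace (dist e 0)⁻¹ e 0
    rwa [SemilinearSpace.real_smul_zero, abs_of_pos (inv_pos.2 hd), inv_mul_cancel₀ hd.ne'] at h

namespace IsUnitDirection

variable {e e' : X} (he : IsUnitDirection e e') {P : X → X} {B : Type*} [NormedAddCommGroup B]
  [NormedSpace ℝ B] {j : X → B}
include he

theorem convexifying_inverse (hX : IsIsotropic X) (hP : IsConvexifying P) : P e' = e' := by
  refine hX.add_right_cancel (z := e) ?_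
  have h := hP.map_add e e'
  rw [he.add_eq_zero, hP.map_zero, hP.map_eq_self he.convex] at h
  rw [add_comm (P e'), ← h, add_comm, he.add_eq_zero]

theorem convexifying_lineMap (hX : IsIsotropic X) (hP : IsConvexifying P) (r : ℝ) :
    P (lineMap e e' r) = lineMap e e' r := by
  rw [lineMap, hP.map_add, hP.map_smul, hP.map_smul, hP.map_eq_self he.convex,
    he.convexifying_inverse hX hP]

/-- The negative half of the line uses the inverse `e'`, because `(-1) • e` need not be inverse to
`e`: convexity concerns nonnegative scalars only. -/
theorem map_lineMap (hj : IsConeEmbedding P j) (r : ℝ) : j (lineMap e e' r) = r • j e := by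
  have h : j e' = -j e := by
    rw [eq_neg_iff_add_eq_zero, add_comm, ← hj.map_add, he.add_eq_zero, hj.map_zero]
  rw [lineMap, hj.map_add, hj.map_smul _ _ (le_max_right _ _), hj.map_smul _ _ (le_max_right _ _),
    h, smul_neg, ← sub_eq_add_neg, ← sub_smul]
  congr 1
  rcases le_total r 0 with h | h
  · rw [max_eq_right h, max_eq_left (by linarith)]; ring
  · rw [max_eq_left h, max_eq_right (by linarith)]; ring

theorem norm_map (hP : IsConvexifying P) (hj : IsConeEmbedding P j) : ‖j e‖ = 1 := by
  rw [← he.dist_zero, hj.dist_eq (hP.map_eq_self he.convex) hP.map_zero, hj.map_zero, sub_zero]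

theorem dist_lineMap (hX : IsIsotropic X) (hP : IsConvexifying P) (hj : IsConeEmbedding P j)
    (r s : ℝ) : dist (lineMap e e' r) (lineMap e e' s) = |r - s| := by
  rw [hj.dist_eq (he.convexifying_lineMap hX hP r) (he.convexifying_lineMap hX hP s),
    he.map_lineMap hj, he.map_lineMap hj, ← sub_smul, norm_smul, he.norm_map hP hj, mul_one,
    Real.norm_eq_abs]

end IsUnitDirection

end Line

/-- The function `⌊(n + 1) φ⌋` for a bounded continuous function `φ`. -/
noncomputable def floorSimpleFunc {φ : ℝ → ℝ} (hφ : Continuous φ) {C : ℝ}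
    (hC : ∀ s, φ s ∈ Icc 0 C) (n : ℕ) : SimpleFunc ℝ ℤ where
  toFun s := ⌊((n : ℝ) + 1) * φ s⌋
  measurableSet_fiber' z :=
    (Int.measurable_floor.comp (hφ.measurable.const_mul ((n : ℝ) + 1))) (measurableSet_singleton z)
  finite_range' := by
    refine (Set.finite_Icc (0 : ℤ) ⌊((n : ℝ) + 1) * C⌋).subset ?_
    rintro _ ⟨s, rfl⟩
    have h1 := (hC s).1
    exact ⟨Int.floor_nonneg.2 (by positivity),
      Int.floor_le_floor (mul_le_mul_of_nonneg_left (hC s).2 (by positivity))⟩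

section Extremal

variable {X : Type*} [LSpace X] {P : X → X} {B : Type*} [NormedAddCommGroup B] [NormedSpace ℝ B]
  [CompleteSpace B] {j : X → B} {e e' : X}

/-- Rounding `φ` down to multiples of `1 / (n + 1)` gives simple functions within `1 / (n + 1)` of
it; boundedness of `φ` keeps their sets of values finite. -/
theorem IsUnitDirection.hasLIntegral (he : IsUnitDirection e e') (hX : IsIsotropic X)
    (hP : IsConvexifying P) (hj : IsConeEmbedding P j) {φ : ℝ → ℝ} (hφ : Continuous φ) {C : ℝ}
    (hC : ∀ s, φ s ∈ Icc 0 C) {a t : ℝ} (hat : a ≤ t) :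
    HasLIntegral P (fun s => lineMap e e' (φ s)) a t (lineMap e e' (∫ s in a..t, φ s)) := by
  let F : ℕ → SimpleFunc ℝ X := fun n =>
    (floorSimpleFunc hφ hC n).map fun z : ℤ => lineMap e e' ((z : ℝ) / ((n : ℝ) + 1))
  have hF : TendstoUniformlyOn (fun n s => F n s) (fun s => lineMap e e' (φ s)) atTop
      (Icc a t) := by
    rw [Metric.tendstoUniformlyOn_iff]
    intro ε hε
    obtain ⟨N, hN⟩ := exists_nat_one_div_lt hε
    filter_upwards [eventually_ge_atTop N] with n hn s _
    have hn0 : (0 : ℝ) < (n : ℝ) + 1 := by positivity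
    refine lt_of_le_of_lt ?_ ((Nat.one_div_le_one_div (α := ℝ) hn).trans_lt hN)
    change dist (lineMap e e' (φ s))
      (lineMap e e' (((⌊((n : ℝ) + 1) * φ s⌋ : ℤ) : ℝ) / ((n : ℝ) + 1))) ≤ _
    rw [he.dist_lineMap hX hP hj]
    have h1 := Int.floor_le (((n : ℝ) + 1) * φ s)
    have h2 := Int.lt_floor_add_one (((n : ℝ) + 1) * φ s)
    have h3 : φ s - (⌊((n : ℝ) + 1) * φ s⌋ : ℝ) / ((n : ℝ) + 1) =
        (((n : ℝ) + 1) * φ s - ⌊((n : ℝ) + 1) * φ s⌋) / ((n : ℝ) + 1) := by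
      field_simp
    rw [h3, abs_of_nonneg (div_nonneg (by linarith) hn0.le)]
    exact div_le_div_of_nonneg_right (by linarith) hn0.le
  refine ⟨F, hF, ?_⟩
  have hc : Continuous fun s => lineMap e e' (φ s) := by
    refine continuous_iff_continuousAt.2 fun s => ?_
    rw [ContinuousAt, tendsto_iff_dist_tendsto_zero]
    simp only [he.dist_lineMap hX hP hj]
    exact tendsto_iff_dist_tendsto_zero.1 (hφ.tendsto s)
  have h := hj.tendsto_map_simpleIntegral hP hat hc.continuousOn hF
  simp only [he.map_lineMap hj] at h
  rw [intervalIntegral.integral_smul_const, ← he.map_lineMap hj] at h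
  rw [tendsto_iff_dist_tendsto_zero] at h ⊢
  refine h.congr fun n => ?_
  rw [hj.dist_eq (IsConeEmbedding.convexifying_simpleIntegral hP _ _ _)
    (he.convexifying_lineMap hX hP _), dist_eq_norm]

/-- `φ` is a bounded continuous nonnegative function that does not vanish on `[a, b]` and satisfies
there `|φ(s) - φ(s')| ≤ ω(|s - s'|)`, with equality for some `s ≠ s'`. -/
structure IsExtremalDensity (ω : ℝ → ℝ) (a b : ℝ) (φ : ℝ → ℝ) : Prop where
  continuous : Continuous φ
  exists_bound : ∃ C, ∀ s, φ s ∈ Icc 0 C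
  abs_sub_le : ∀ s ∈ Icc a b, ∀ s' ∈ Icc a b, |φ s - φ s'| ≤ ω |s - s'|
  exists_eq : ∃ s ∈ Icc a b, ∃ s' ∈ Icc a b, s ≠ s' ∧ |φ s - φ s'| = ω |s - s'|
  exists_pos : ∃ c ∈ Icc a b, 0 < φ c

/-- An extremal density is the norm of the derivative of an element of `W¹H^ω` whose values at the
two endpoints are opposite. -/
theorem IsExtremalDensity.exists_memW (hX : IsIsotropic X)
    (hinv : invertibleElements X ∩ convexElements X ≠ {0}) (hP : IsConvexifying P)
    {a b : ℝ} (hab : a < b) {ω : ℝ → ℝ} (hω : IsModulus ω) (hω0 : ∃ s, 0 ≤ s ∧ ω s ≠ 0)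
    {φ : ℝ → ℝ} (hdens : IsExtremalDensity ω a b φ) :
    ∃ f : ℝ → X, MemW P ω a b f ∧ normOmega ω a b (hukuharaDeriv a b f) = 1 ∧
      0 < normC a b f ∧ normC a b f = (∫ s in a..b, φ s) / 2 ∧
      (∀ t γ₁ γ₂ : ℝ, a ≤ t - γ₁ → t + γ₂ ≤ b → 0 ≤ γ₁ + γ₂ →
        normL (dividedDiff γ₁ γ₂ f t) = (γ₁ + γ₂)⁻¹ * ∫ s in (t - γ₁)..(t + γ₂), φ s) ∧
      ∀ t ∈ Icc a b, normL (hukuharaDeriv a b f t) = φ t := by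
  obtain ⟨hφ, ⟨C, hC⟩, hφω, heq, hpos⟩ := hdens
  obtain ⟨B, _, _, _, j, hj⟩ := exists_isConeEmbedding hX hP
  obtain ⟨e, e', he⟩ := exists_isUnitDirection hinv
  have hi : ∀ x y, IntervalIntegrable φ volume x y := fun x y => hφ.intervalIntegrable x y
  have hI : 0 < ∫ s in a..b, φ s :=
    intervalIntegral.integral_pos hab hφ.continuousOn (fun s _ => (hC s).1) hpos
  set I := ∫ s in a..b, φ s with hIdef
  have hPl := he.convexifying_lineMap hX hP
  -- Since `φ ≥ 0`, the coordinate of `f` along the line increases from `-I / 2` to `I / 2`. This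
  -- centring makes `‖f‖_C` equal to `I / 2`, so the bound `2 ‖f‖_C` on increments is attained.
  set f : ℝ → X := fun s => lineMap e e' (-(I / 2)) + lineMap e e' (∫ r in a..s, φ r) with hf
  have hPf : ∀ s, P (f s) = f s := fun s => by rw [hf, hP.map_add, hPl, hPl]
  have hjf : ∀ s, j (f s) = (-(I / 2) + ∫ r in a..s, φ r) • j e := fun s => by
    rw [hf, hj.map_add, he.map_lineMap hj, he.map_lineMap hj, add_smul]
  have hnf : ∀ s, normL (f s) = |-(I / 2) + ∫ r in a..s, φ r| := fun s => by
    rw [hj.normL_eq hP (hPf s), hjf, norm_smul, he.norm_map hP hj, mul_one, Real.norm_eq_abs]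
  have hint : ∀ s s', ∫ r in s..s', j (lineMap e e' (φ r)) = (∫ r in s..s', φ r) • j e :=
    fun s s' => by
      simp only [he.map_lineMap hj]
      rw [intervalIntegral.integral_smul_const]
  have hprim : IsHukuharaPrimitive P j a b f fun s => lineMap e e' (φ s) := by
    refine ⟨fun s _ => hPf s, fun s => hPl _, ?_, fun s _ s' _ _ => ?_⟩
    · simp only [he.map_lineMap hj]
      exact (hφ.smul continuous_const).continuousOn
    · refine ⟨lineMap e e' (∫ r in s..s', φ r), hPl _, ?_, ?_⟩
      · refine hj.eq_of_map_eq (hPf s') (by rw [hP.map_add, hPf, hPl]) ?_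
        rw [hjf s', hj.map_add (f s), hjf s, he.map_lineMap hj, ← add_smul,
          ← intervalIntegral.integral_add_adjacent_intervals (hi a s) (hi s s'), add_assoc]
      · rw [he.map_lineMap hj, hint]
  have hder : ∀ t ∈ Icc a b, hukuharaDeriv a b f t = lineMap e e' (φ t) := fun t ht =>
    hprim.hukuharaDeriv_eq hab hX hP hj ht
  have hnl : ∀ r, normL (lineMap e e' r) = |r| := fun r => by
    rw [hj.normL_eq hP (hPl r), he.map_lineMap hj, norm_smul, he.norm_map hP hj, mul_one,
      Real.norm_eq_abs]
  have hnormC : normC a b f = I / 2 := by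
    refine IsGreatest.csSup_eq ⟨⟨a, left_mem_Icc.2 hab.le, ?_⟩, ?_⟩
    · rw [hnf, intervalIntegral.integral_same, add_zero, abs_neg, abs_of_pos (by linarith)]
    · rintro _ ⟨t, ht, rfl⟩
      have h1 : 0 ≤ ∫ r in a..t, φ r :=
        intervalIntegral.integral_nonneg ht.1 fun s _ => (hC s).1
      have h2 : 0 ≤ ∫ r in t..b, φ r :=
        intervalIntegral.integral_nonneg ht.2 fun s _ => (hC s).1
      have h3 := intervalIntegral.integral_add_adjacent_intervals (hi a t) (hi t b)
      rw [hnf, abs_le]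
      constructor <;> linarith
  refine ⟨f, ⟨fun s => lineMap e e' (φ s), fun s hs s' hs' => ?_, lineMap e e' (-(I / 2)), ?_,
    fun t ht => ⟨_, he.hasLIntegral hX hP hj hφ hC ht.1, rfl⟩⟩, ?_, ?_, hnormC, ?_, ?_⟩
  · rw [he.dist_lineMap hX hP hj]
    exact hφω s hs s' hs'
  · rw [← hPl]
    exact hP.mem_convex _
  · have hquot : ∀ s ∈ Icc a b, ∀ s' ∈ Icc a b,
        dist (hukuharaDeriv a b f s) (hukuharaDeriv a b f s') = |φ s - φ s'| :=
      fun s hs s' hs' => by rw [hder s hs, hder s' hs', he.dist_lineMap hX hP hj]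
    refine IsGreatest.csSup_eq ⟨?_, ?_⟩
    · obtain ⟨s, hs, s', hs', hne, h⟩ := heq
      refine ⟨s, hs, s', hs', hne, ?_⟩
      rw [hquot s hs s' hs', h, div_self (hω.pos hω0 (abs_pos.2 (sub_ne_zero.2 hne))).ne']
    · rintro _ ⟨s, hs, s', hs', hne, rfl⟩
      rw [hquot s hs s' hs', div_le_one (hω.pos hω0 (abs_pos.2 (sub_ne_zero.2 hne)))]
      exact hφω s hs s' hs'
  · rw [hnormC]
    linarith
  · intro t γ₁ γ₂ h1 h2 hγ
    rw [hprim.normL_dividedDiff hX hP hj ⟨h1, by linarith⟩ ⟨by linarith, h2⟩ hγ, hint, smul_smul,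
      norm_smul, he.norm_map hP hj, mul_one, Real.norm_of_nonneg]
    exact mul_nonneg (inv_nonneg.2 hγ)
      (intervalIntegral.integral_nonneg (by linarith) fun s _ => (hC s).1)
  · intro t ht
    rw [hder t ht, hnl, abs_of_nonneg (hC t).1]

end Extremal

/-! ### Real extremal densities for an arbitrary modulus of continuity. -/

theorem intervalIntegral_eq_of_eq_zero {φ : ℝ → ℝ} (hφ : Continuous φ) {a b m n : ℝ} (ham : a ≤ m)
    (hnb : n ≤ b) (hl : ∀ s ∈ Ioo a m, φ s = 0) (hr : ∀ s ∈ Ioo n b, φ s = 0) :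
    ∫ s in a..b, φ s = ∫ s in m..n, φ s := by
  have hi : ∀ x y, IntervalIntegrable φ volume x y := fun x y => hφ.intervalIntegrable x y
  have h0 : ∀ x y, x ≤ y → (∀ s ∈ Ioo x y, φ s = 0) → ∫ s in x..y, φ s = 0 := fun x y hxy h => by
    rw [intervalIntegral.integral_of_le hxy, integral_Ioc_eq_integral_Ioo]
    exact setIntegral_eq_zero_of_forall_eq_zero h
  rw [← intervalIntegral.integral_add_adjacent_intervals (hi a m) (hi m b),
    ← intervalIntegral.integral_add_adjacent_intervals (hi m n) (hi n b), h0 a m ham hl,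
    h0 n b hnb hr, zero_add, add_zero]

/-- A function `d ≥ 0` with `|d(s) - d(s')| ≤ ω(|s - s'|)`, turned over and cut off at height `A`,
is an extremal density. -/
theorem IsExtremalDensity.of_drop {ω : ℝ → ℝ} {a b A : ℝ} {d : ℝ → ℝ} (hd : Continuous d)
    (hd0 : ∀ s, 0 ≤ d s)
    (hdω : ∀ s ∈ Icc a b, ∀ s' ∈ Icc a b, |d s - d s'| ≤ ω |s - s'|) (hA : 0 < A)
    {c s₀ : ℝ} (hc : c ∈ Icc a b) (hs₀ : s₀ ∈ Icc a b) (hne : c ≠ s₀) (hdc : d c = 0)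
    (hds₀ : d s₀ = ω |c - s₀|) (hle : d s₀ ≤ A) :
    IsExtremalDensity ω a b fun s => max 0 (A - d s) := by
  refine ⟨by fun_prop, ⟨A, fun s => ⟨le_max_left _ _, max_le hA.le (by linarith [hd0 s])⟩⟩,
    fun s hs s' hs' => ?_, ⟨c, hc, s₀, hs₀, hne, ?_⟩, ⟨c, hc, by simp [hdc, hA]⟩⟩
  · simp only [max_comm (0 : ℝ)]
    refine (abs_max_sub_max_le_abs (A - d s) (A - d s') 0).trans ?_
    rw [sub_sub_sub_cancel_left, abs_sub_comm]
    exact hdω s hs s' hs'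
  · rw [← hds₀, hdc, max_eq_right (by linarith), max_eq_right (by linarith), sub_zero,
      sub_sub_cancel, abs_of_nonneg (hd0 s₀)]

/-- With this height the tent is not cut off between `t` and the farther of `t - h₁`, `t + h₂`;
those two points realise equality with `ω`. -/
theorem IsModulus.isExtremalDensity_tent {ω : ℝ → ℝ} (hω : IsModulus ω)
    (hω0 : ∃ s, 0 ≤ s ∧ ω s ≠ 0) {a b t h₁ h₂ : ℝ} (h1 : 0 ≤ h₁) (h2 : 0 ≤ h₂)
    (hh : 0 < h₁ + h₂) (ha : a ≤ t - h₁) (hb : t + h₂ ≤ b) :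
    IsExtremalDensity ω a b fun s => max 0 (ω (max h₁ h₂) - ω |s - t|) := by
  have hH : 0 < max h₁ h₂ := by
    rcases le_total h₁ h₂ with h | h
    · rw [max_eq_right h]; linarith
    · rw [max_eq_left h]; linarith
  obtain ⟨s₀, hs₀, hts₀⟩ : ∃ s₀ ∈ Icc a b, |s₀ - t| = max h₁ h₂ := by
    rcases le_total h₁ h₂ with h | h
    · exact ⟨t + h₂, ⟨by linarith, hb⟩, by
        rw [add_sub_cancel_left, abs_of_nonneg h2, max_eq_right h]⟩
    · exact ⟨t - h₁, ⟨ha, by linarith⟩, by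
        rw [sub_sub_cancel_left, abs_neg, abs_of_nonneg h1, max_eq_left h]⟩
  refine IsExtremalDensity.of_drop (c := t) (s₀ := s₀)
    (hω.continuous_comp (by fun_prop) fun _ => abs_nonneg _) (fun s => hω.nonneg (abs_nonneg _))
    (fun s _ s' _ => ?_) (hω.pos hω0 hH) ⟨by linarith, by linarith⟩ hs₀ ?_ ?_ ?_ ?_
  · refine (hω.abs_sub_le (abs_nonneg _) (abs_nonneg _)).trans ?_
    refine hω.monotoneOn (mem_Ici.2 (abs_nonneg _)) (mem_Ici.2 (abs_nonneg _)) ?_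
    have := abs_abs_sub_abs_le_abs_sub (s - t) (s' - t)
    rwa [sub_sub_sub_cancel_right] at this
  · rintro rfl
    rw [sub_self, abs_zero] at hts₀
    linarith
  · rw [sub_self, abs_zero, hω.map_zero]
  · rw [abs_sub_comm]
  · rw [hts₀]

/-- Only differences between `t` and other points occur in `sub_average`, and for the tent these
equal `ω` of the distance, so concavity plays no role. By `hl` and `hr`, a side with room left in
`[a, b]` is a longest one, so the tent vanishes beyond it. -/
theorem IsModulus.tent_eq_average_add {ω : ℝ → ℝ} (hω : IsModulus ω)
    {a b t h₁ h₂ : ℝ} (h1 : 0 ≤ h₁) (h2 : 0 ≤ h₂)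
    (hh : 0 < h₁ + h₂) (ha : a ≤ t - h₁) (hb : t + h₂ ≤ b)
    (hl : a < t - h₁ → h₂ ≤ h₁) (hr : t + h₂ < b → h₁ ≤ h₂) {φ : ℝ → ℝ}
    (hφ : φ = fun s => max 0 (ω (max h₁ h₂) - ω |s - t|)) :
    φ t = (modulusIntegral ω h₁ + modulusIntegral ω h₂) / (h₁ + h₂) +
      (h₁ + h₂)⁻¹ * ∫ s in a..b, φ s := by
  have hφc : Continuous φ := by
    have : Continuous fun s => ω |s - t| :=
      hω.continuous_comp (by fun_prop) fun _ => abs_nonneg _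
    rw [hφ]
    exact continuous_const.max (continuous_const.sub this)
  have hout : ∀ s, max h₁ h₂ ≤ |s - t| → φ s = 0 := fun s hs => by
    have := hω.monotoneOn (mem_Ici.2 (h1.trans (le_max_left _ _))) (mem_Ici.2 (abs_nonneg _)) hs
    simp only [hφ]
    exact max_eq_left (by linarith)
  have hin : ∀ s, |s - t| ≤ max h₁ h₂ → φ t - φ s = ω |s - t| := fun s hs => by
    have := hω.monotoneOn (mem_Ici.2 (abs_nonneg _)) (mem_Ici.2 (h1.trans (le_max_left _ _))) hs
    simp only [hφ]
    rw [sub_self, abs_zero, hω.map_zero, sub_zero,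
      max_eq_right (hω.nonneg (h1.trans (le_max_left _ _))), max_eq_right (sub_nonneg.2 this),
      sub_sub_cancel]
  have hint : ∫ s in a..b, φ s = ∫ s in (t - h₁)..(t + h₂), φ s := by
    refine intervalIntegral_eq_of_eq_zero hφc ha hb (fun s hs => hout s ?_) fun s hs => hout s ?_
    · rw [max_eq_left (hl (hs.1.trans hs.2)), abs_sub_comm]
      exact (by linarith [hs.2] : h₁ ≤ t - s).trans (le_abs_self _)
    · rw [max_eq_right (hr (hs.1.trans hs.2))]
      exact (by linarith [hs.1] : h₂ ≤ s - t).trans (le_abs_self _)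
  have e2 : t + h₂ - (t - h₁) = h₁ + h₂ := by ring
  have h := sub_average hφc (A := t - h₁) (t := t) (D := t + h₂) (by linarith)
  rw [e2, sub_sub_cancel, add_sub_cancel_left, smul_eq_mul, smul_eq_mul] at h
  have i1 : ∫ u in (0 : ℝ)..h₁, (φ t - φ (t - u)) = modulusIntegral ω h₁ := by
    refine intervalIntegral.integral_congr fun u hu => ?_
    rw [uIcc_of_le h1] at hu
    have hu' : |t - u - t| = u := by rw [sub_sub_cancel_left, abs_neg, abs_of_nonneg hu.1]
    change φ t - φ (t - u) = ω u
    rw [hin _ (by rw [hu']; exact hu.2.trans (le_max_left _ _)), hu']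
  have i2 : ∫ u in (0 : ℝ)..h₂, (φ t - φ (t + u)) = modulusIntegral ω h₂ := by
    refine intervalIntegral.integral_congr fun u hu => ?_
    rw [uIcc_of_le h2] at hu
    have hu' : |t + u - t| = u := by rw [add_sub_cancel_left, abs_of_nonneg hu.1]
    change φ t - φ (t + u) = ω u
    rw [hin _ (by rw [hu']; exact hu.2.trans (le_max_right _ _)), hu']
  rw [i1, i2] at h
  rw [hint, div_eq_inv_mul]
  linarith

/-! ### Real extremal densities for a concave modulus of continuity. -/

/-- The decrease, at the distance `y` from its maximum, of the function extremal for a concave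
modulus of continuity; it is `ω(D)` at the distance `D`. -/
noncomputable def concaveDrop (ω : ℝ → ℝ) (p q D y : ℝ) : ℝ :=
  p * (ω D - ω (max (D - y / p) 0)) + q * ω (max ((y - p * D) / q) 0)

namespace IsModulus

variable {ω : ℝ → ℝ} (hω : IsModulus ω) {p q D : ℝ}
include hω

theorem continuous_concaveDrop : Continuous (concaveDrop ω p q D) := by
  have h1 : Continuous fun y : ℝ => ω (max (D - y / p) 0) :=
    hω.continuous_comp ((continuous_const.sub (continuous_id.div_const p)).max continuous_const)
      fun _ => le_max_right _ _
  have h2 : Continuous fun y : ℝ => ω (max ((y - p * D) / q) 0) :=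
    hω.continuous_comp (((continuous_id.sub continuous_const).div_const q).max continuous_const)
      fun _ => le_max_right _ _
  exact (continuous_const.mul (continuous_const.sub h1)).add (continuous_const.mul h2)

theorem concaveDrop_zero (hp : 0 ≤ p) (hq : 0 ≤ q) (hD : 0 ≤ D) : concaveDrop ω p q D 0 = 0 := by
  have h : (0 - p * D) / q ≤ 0 := div_nonpos_of_nonpos_of_nonneg (by nlinarith) hq
  rw [concaveDrop, zero_div, sub_zero, max_eq_left hD, max_eq_right h, hω.map_zero]
  ring

theorem concaveDrop_mono (hp : 0 < p) (hq : 0 < q) : Monotone (concaveDrop ω p q D) := by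
  intro y y' h
  have h1 : ω (max (D - y' / p) 0) ≤ ω (max (D - y / p) 0) :=
    hω.monotoneOn (mem_Ici.2 (le_max_right _ _)) (mem_Ici.2 (le_max_right _ _)) (by gcongr)
  have h2 : ω (max ((y - p * D) / q) 0) ≤ ω (max ((y' - p * D) / q) 0) :=
    hω.monotoneOn (mem_Ici.2 (le_max_right _ _)) (mem_Ici.2 (le_max_right _ _)) (by gcongr)
  unfold concaveDrop
  gcongr

/-- By subadditivity the increment is at most `p ω(α) + q ω(β)`, where `α` and `β` are the changes
of the two inner arguments. Concavity bounds this by `ω(p α + q β)`, and `p α + q β = y - y'`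
because the scaled arguments are the positive and negative parts of `p D - y`. -/
theorem concaveDrop_sub_le (hc : ConcaveOn ℝ (Ici 0) ω) (hp : 0 < p) (hq : 0 < q)
    (hpq : p + q = 1) {y y' : ℝ} (h : y' ≤ y) :
    concaveDrop ω p q D y - concaveDrop ω p q D y' ≤ ω (y - y') := by
  have h1 : max (D - y / p) 0 ≤ max (D - y' / p) 0 := by gcongr
  have h2 : max ((y' - p * D) / q) 0 ≤ max ((y - p * D) / q) 0 := by gcongr
  have a1 := (le_abs_self _).trans (hω.abs_sub_le (le_max_right (D - y' / p) 0)
    (le_max_right (D - y / p) 0))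
  have a2 := (le_abs_self _).trans (hω.abs_sub_le (le_max_right ((y - p * D) / q) 0)
    (le_max_right ((y' - p * D) / q) 0))
  rw [abs_of_nonneg (sub_nonneg.2 h1)] at a1
  rw [abs_of_nonneg (sub_nonneg.2 h2)] at a2
  have h3 := hc.2 (mem_Ici.2 (sub_nonneg.2 h1)) (mem_Ici.2 (sub_nonneg.2 h2)) hp.le hq.le hpq
  have hpm : ∀ z, p * max (D - z / p) 0 = max (p * D - z) 0 := fun z => by
    rw [mul_max_of_nonneg _ _ hp.le, mul_zero, mul_sub, mul_div_cancel₀ _ hp.ne']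
  have hqm : ∀ z, q * max ((z - p * D) / q) 0 = max (-(p * D - z)) 0 := fun z => by
    rw [mul_max_of_nonneg _ _ hq.le, mul_zero, mul_div_cancel₀ _ hq.ne', neg_sub]
  have hpn : ∀ z : ℝ, max z 0 - max (-z) 0 = z := fun z => by
    rcases le_total z 0 with h | h
    · rw [max_eq_right h, max_eq_left (by linarith)]; ring
    · rw [max_eq_left h, max_eq_right (by linarith)]; ring
  have h4 : p • (max (D - y' / p) 0 - max (D - y / p) 0) +
      q • (max ((y - p * D) / q) 0 - max ((y' - p * D) / q) 0) = y - y' := by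
    simp only [smul_eq_mul, mul_sub, hpm, hqm]
    linarith [hpn (p * D - y), hpn (p * D - y')]
  rw [h4, smul_eq_mul, smul_eq_mul] at h3
  have b1 := mul_le_mul_of_nonneg_left a1 hp.le
  have b2 := mul_le_mul_of_nonneg_left a2 hq.le
  unfold concaveDrop
  linarith

theorem concaveDrop_self (hp : 0 < p) (hq : 0 < q) (hpq : p + q = 1) (hD : 0 ≤ D) :
    concaveDrop ω p q D D = ω D := by
  have h1 : D - D / p ≤ 0 := by
    rw [sub_nonpos, le_div_iff₀ hp]
    nlinarith
  have h2 : (D - p * D) / q = D := by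
    rw [div_eq_iff hq.ne']
    linear_combination (-D) * hpq
  rw [concaveDrop, max_eq_right h1, h2, max_eq_left hD, hω.map_zero, sub_zero, ← add_mul, hpq,
    one_mul]

/-- This dictates the shape of `concaveDrop`. The two points lie on opposite sides of `p D` at
distance `v` from each other; the drops there are `p ω(D) + q ω(v)` and `p ω(D) - p ω(v)`. -/
theorem concaveDrop_matched (hp : 0 < p) (hq : 0 < q) {v : ℝ} (hv : 0 ≤ v)
    (hpq : p + q = 1) :
    concaveDrop ω p q D (p * D + q * v) - concaveDrop ω p q D (p * (D - v)) = ω v := by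
  have h1 : (p * D + q * v - p * D) / q = v := by field_simp; ring
  have h2 : D - (p * D + q * v) / p ≤ 0 := by
    rw [sub_nonpos, le_div_iff₀ hp]
    nlinarith
  have h3 : (p * (D - v) - p * D) / q ≤ 0 :=
    div_nonpos_of_nonpos_of_nonneg (by nlinarith) hq.le
  have h4 : D - p * (D - v) / p = v := by field_simp; ring
  rw [concaveDrop, concaveDrop, h1, max_eq_right h2, max_eq_right h3, h4, max_eq_left hv,
    hω.map_zero]
  linear_combination ω v * hpq

end IsModulus

/-- The decrease from its maximum at `c` of the extremal function with the total decrease `ω(D₁)`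
on `[c - D₁, c]` and `ω(D₂)` on `[c, c + D₂]`. -/
noncomputable def twoSidedDrop (ω : ℝ → ℝ) (p q D₁ D₂ c s : ℝ) : ℝ :=
  concaveDrop ω p q D₁ (max (c - s) 0) + concaveDrop ω p q D₂ (max (s - c) 0)

namespace IsModulus

variable {ω : ℝ → ℝ} (hω : IsModulus ω) {p q D₁ D₂ c : ℝ}
include hω

theorem continuous_twoSidedDrop : Continuous (twoSidedDrop ω p q D₁ D₂ c) := by
  have h1 := hω.continuous_concaveDrop (p := p) (q := q) (D := D₁)
  have h2 := hω.continuous_concaveDrop (p := p) (q := q) (D := D₂)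
  unfold twoSidedDrop
  fun_prop

theorem twoSidedDrop_left (hp : 0 < p) (hq : 0 < q) (h2 : 0 ≤ D₂) {s : ℝ} (hs : s ≤ c) :
    twoSidedDrop ω p q D₁ D₂ c s = concaveDrop ω p q D₁ (c - s) := by
  rw [twoSidedDrop, max_eq_left (by linarith), max_eq_right (by linarith),
    hω.concaveDrop_zero hp.le hq.le h2, add_zero]

theorem twoSidedDrop_right (hp : 0 < p) (hq : 0 < q) (h1 : 0 ≤ D₁) {s : ℝ} (hs : c ≤ s) :
    twoSidedDrop ω p q D₁ D₂ c s = concaveDrop ω p q D₂ (s - c) := by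
  rw [twoSidedDrop, max_eq_right (by linarith), max_eq_left (by linarith),
    hω.concaveDrop_zero hp.le hq.le h1, zero_add]

theorem concaveDrop_nonneg (hp : 0 < p) (hq : 0 < q) {D : ℝ} (hD : 0 ≤ D) {y : ℝ} (hy : 0 ≤ y) :
    0 ≤ concaveDrop ω p q D y := by
  rw [← hω.concaveDrop_zero hp.le hq.le hD]
  exact hω.concaveDrop_mono hp hq hy

theorem twoSidedDrop_nonneg (hp : 0 < p) (hq : 0 < q) (h1 : 0 ≤ D₁) (h2 : 0 ≤ D₂) (s : ℝ) :
    0 ≤ twoSidedDrop ω p q D₁ D₂ c s :=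
  add_nonneg (hω.concaveDrop_nonneg hp hq h1 (le_max_right _ _))
    (hω.concaveDrop_nonneg hp hq h2 (le_max_right _ _))

/-- On one side of `c` this is the estimate for `concaveDrop`. Across `c` both drops are
nonnegative, so their difference is at most the larger one, which is bounded by `ω` of the distance
to `c`. -/
theorem abs_twoSidedDrop_sub_le (hc : ConcaveOn ℝ (Ici 0) ω) (hp : 0 < p) (hq : 0 < q)
    (hpq : p + q = 1) (h1 : 0 ≤ D₁) (h2 : 0 ≤ D₂) (s s' : ℝ) :
    |twoSidedDrop ω p q D₁ D₂ c s - twoSidedDrop ω p q D₁ D₂ c s'| ≤ ω |s - s'| := by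
  wlog h : s ≤ s' generalizing s s'
  · rw [abs_sub_comm, abs_sub_comm s]
    exact this s' s (by linarith)
  have mono : ∀ {x y : ℝ}, 0 ≤ x → x ≤ y → ω x ≤ ω y := fun hx hxy =>
    hω.monotoneOn (mem_Ici.2 hx) (mem_Ici.2 (hx.trans hxy)) hxy
  have top : ∀ {D y : ℝ}, 0 ≤ D → 0 ≤ y → concaveDrop ω p q D y ≤ ω y := fun {D y} hD hy => by
    have := hω.concaveDrop_sub_le (D := D) hc hp hq hpq hy
    rwa [hω.concaveDrop_zero hp.le hq.le hD, sub_zero, sub_zero] at this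
  rw [abs_of_nonpos (sub_nonpos.2 h), neg_sub]
  rcases le_total s' c with hs' | hs'
  · rw [hω.twoSidedDrop_left hp hq h2 hs', hω.twoSidedDrop_left hp hq h2 (h.trans hs'),
      abs_of_nonneg (sub_nonneg.2 (hω.concaveDrop_mono hp hq (by linarith)))]
    have := hω.concaveDrop_sub_le (D := D₁) hc hp hq hpq (y := c - s) (y' := c - s') (by linarith)
    rwa [sub_sub_sub_cancel_left] at this
  rcases le_total c s with hs | hs
  · rw [hω.twoSidedDrop_right hp hq h1 hs', hω.twoSidedDrop_right hp hq h1 hs, abs_sub_comm,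
      abs_of_nonneg (sub_nonneg.2 (hω.concaveDrop_mono hp hq (by linarith)))]
    have := hω.concaveDrop_sub_le (D := D₂) hc hp hq hpq (y := s' - c) (y' := s - c) (by linarith)
    rwa [sub_sub_sub_cancel_right] at this
  · rw [hω.twoSidedDrop_left hp hq h2 hs, hω.twoSidedDrop_right hp hq h1 hs']
    have t1 := top h1 (sub_nonneg.2 hs)
    have t2 := top h2 (sub_nonneg.2 hs')
    have n1 := hω.concaveDrop_nonneg hp hq h1 (sub_nonneg.2 hs)
    have n2 := hω.concaveDrop_nonneg hp hq h2 (sub_nonneg.2 hs')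
    have m1 := mono (sub_nonneg.2 hs) (by linarith : c - s ≤ s' - s)
    have m2 := mono (sub_nonneg.2 hs') (by linarith : s' - c ≤ s' - s)
    rw [abs_le]
    constructor <;> linarith

theorem isExtremalDensity_twoSided (hω0 : ∃ s, 0 ≤ s ∧ ω s ≠ 0) (hc : ConcaveOn ℝ (Ici 0) ω)
    (hp : 0 < p) (hq : 0 < q) (hpq : p + q = 1) (h1 : 0 ≤ D₁) (h2 : 0 ≤ D₂) (hD : 0 < D₁ + D₂)
    {a b : ℝ} (ha : a ≤ c - D₁) (hb : c + D₂ ≤ b) :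
    IsExtremalDensity ω a b fun s =>
      max 0 (ω (max D₁ D₂) - twoSidedDrop ω p q D₁ D₂ c s) := by
  have hmax : 0 < max D₁ D₂ := by
    rcases le_total D₁ D₂ with h | h
    · rw [max_eq_right h]; linarith
    · rw [max_eq_left h]; linarith
  obtain ⟨s₀, hs₀, hdist, hdrop⟩ : ∃ s₀ ∈ Icc a b, |c - s₀| = max D₁ D₂ ∧
      twoSidedDrop ω p q D₁ D₂ c s₀ = ω (max D₁ D₂) := by
    rcases le_total D₁ D₂ with h | h
    · refine ⟨c + D₂, ⟨by linarith, hb⟩, ?_, ?_⟩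
      · rw [sub_add_cancel_left, abs_neg, abs_of_nonneg h2, max_eq_right h]
      · rw [hω.twoSidedDrop_right hp hq h1 (by linarith), add_sub_cancel_left,
          hω.concaveDrop_self hp hq hpq h2, max_eq_right h]
    · refine ⟨c - D₁, ⟨ha, by linarith⟩, ?_, ?_⟩
      · rw [sub_sub_cancel, abs_of_nonneg h1, max_eq_left h]
      · rw [hω.twoSidedDrop_left hp hq h2 (by linarith), sub_sub_cancel,
          hω.concaveDrop_self hp hq hpq h1, max_eq_left h]
  refine IsExtremalDensity.of_drop (c := c) (s₀ := s₀) hω.continuous_twoSidedDrop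
    (hω.twoSidedDrop_nonneg hp hq h1 h2)
    (fun s _ s' _ => hω.abs_twoSidedDrop_sub_le hc hp hq hpq h1 h2 s s') (hω.pos hω0 hmax)
    ⟨by linarith, by linarith⟩ hs₀ ?_ ?_ (by rw [hdrop, hdist]) hdrop.le
  · rintro rfl
    rw [sub_self, abs_zero] at hdist
    linarith
  · rw [hω.twoSidedDrop_left hp hq h2 le_rfl, sub_self, hω.concaveDrop_zero hp.le hq.le h1]

/-- For a concave modulus of continuity the extremal density attains the bound `K` for the
difference of its averages. -/
theorem exists_isExtremalDensity_average (hω0 : ∃ s, 0 ≤ s ∧ ω s ≠ 0)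
    (hc : ConcaveOn ℝ (Ici 0) ω) {a b t γ₁ γ₂ h₁ h₂ : ℝ} (h1 : γ₁ ≤ h₁) (h2 : γ₂ ≤ h₂)
    (hγ : 0 < γ₁ + γ₂) (hlt : γ₁ + γ₂ < h₁ + h₂) (ha : a ≤ t - h₁) (hb : t + h₂ ≤ b)
    (hl : a < t - h₁ → h₂ - γ₂ ≤ h₁ - γ₁) (hr : t + h₂ < b → h₁ - γ₁ ≤ h₂ - γ₂) :
    ∃ φ, IsExtremalDensity ω a b φ ∧
      (γ₁ + γ₂)⁻¹ * (∫ s in (t - γ₁)..(t + γ₂), φ s) =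
        landauK ω γ₁ γ₂ h₁ h₂ + (h₁ + h₂)⁻¹ * ∫ s in a..b, φ s := by
  have hh : 0 < h₁ + h₂ := by linarith
  rw [landauK_eq ω hh hlt]
  set w := (h₁ - γ₁) + (h₂ - γ₂) with hwdef
  have hw : 0 < w := by linarith
  set κ := (h₁ + h₂) / w with hκdef
  set r := (γ₁ + γ₂) / w with hrdef
  -- The weights are the shares of the inner interval and of the gaps in the outer interval; `κ u`
  -- is the distance of a pair in `average_sub_average`.
  set p := (γ₁ + γ₂) / (h₁ + h₂) with hpdef
  set q := w / (h₁ + h₂) with hqdef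
  have hp : 0 < p := div_pos hγ hh
  have hq : 0 < q := div_pos hw hh
  have hκ : 0 < κ := div_pos hh hw
  have hr0 : 0 < r := div_pos hγ hw
  have hpq : p + q = 1 := by
    rw [hpdef, hqdef, ← add_div, div_eq_one_iff_eq hh.ne', hwdef]
    ring
  have hpκ : p * κ = r := by rw [hpdef, hκdef, hrdef]; field_simp
  have hqκ : q * κ = 1 := by rw [hqdef, hκdef]; field_simp
  have hκr : κ = r + 1 := by rw [← hpκ, ← hqκ, ← add_mul, hpq, one_mul]
  have hrw : r * w = γ₁ + γ₂ := div_mul_cancel₀ _ hw.ne'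
  set u₁ := h₁ - γ₁ with hu₁
  set u₂ := h₂ - γ₂ with hu₂
  have h01 : 0 ≤ u₁ := sub_nonneg.2 h1
  have h02 : 0 ≤ u₂ := sub_nonneg.2 h2
  have hD1 : 0 ≤ κ * u₁ := by positivity
  have hD2 : 0 ≤ κ * u₂ := by positivity
  -- The maximum sits where the images of the two gaps meet. Its distances to the ends of the outer
  -- interval are `κ u₁` and `κ u₂`, of which the fraction `p` lies in the inner interval.
  set c := t - γ₁ + r * u₁ with hcdef
  have hc2 : c = t + γ₂ - r * u₂ := by
    rw [hcdef]
    linear_combination hrw - r * hwdef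
  have hcl : c - κ * u₁ = t - h₁ := by rw [hκr, hcdef, hu₁]; ring
  have hcr : c + κ * u₂ = t + h₂ := by rw [hκr, hc2, hu₂]; ring
  have hdens := hω.isExtremalDensity_twoSided (c := c) hω0 hc hp hq hpq hD1 hD2
    (by rw [← mul_add]; positivity) (hcl ▸ ha) (hcr ▸ hb)
  set d := twoSidedDrop ω p q (κ * u₁) (κ * u₂) c with hd
  set A := ω (max (κ * u₁) (κ * u₂)) with hA
  have mono : ∀ {x y : ℝ}, 0 ≤ x → x ≤ y → ω x ≤ ω y := fun hx hxy =>
    hω.monotoneOn (mem_Ici.2 hx) (mem_Ici.2 (hx.trans hxy)) hxy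
  have hdl : ∀ s, s ≤ c → d s = concaveDrop ω p q (κ * u₁) (c - s) := fun s hs =>
    hω.twoSidedDrop_left hp hq hD2 hs
  have hdr : ∀ s, c ≤ s → d s = concaveDrop ω p q (κ * u₂) (s - c) := fun s hs =>
    hω.twoSidedDrop_right hp hq hD1 hs
  set φ : ℝ → ℝ := fun s => max 0 (A - d s) with hφ
  have hφc : Continuous φ := hdens.continuous
  have hA1 : ω (κ * u₁) ≤ A := mono hD1 (le_max_left _ _)
  have hA2 : ω (κ * u₂) ≤ A := mono hD2 (le_max_right _ _)
  have hsl := hω.concaveDrop_self hp hq hpq hD1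
  have hsr := hω.concaveDrop_self hp hq hpq hD2
  have hinl : ∀ s, t - h₁ ≤ s → s ≤ c → φ s = A - concaveDrop ω p q (κ * u₁) (c - s) :=
    fun s hs hs' => by
      have := hω.concaveDrop_mono (D := κ * u₁) hp hq (by linarith : c - s ≤ κ * u₁)
      simp only [hφ, hdl s hs']
      exact max_eq_right (by linarith)
  have hinr : ∀ s, c ≤ s → s ≤ t + h₂ → φ s = A - concaveDrop ω p q (κ * u₂) (s - c) :=
    fun s hs hs' => by
      have := hω.concaveDrop_mono (D := κ * u₂) hp hq (by linarith : s - c ≤ κ * u₂)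
      simp only [hφ, hdr s hs]
      exact max_eq_right (by linarith)
  -- If the outer interval stops before `a` or `b` on some side, that side has the larger total drop
  -- by `hl` or `hr`, so the cut-off leaves zero beyond it.
  have hint : ∫ s in a..b, φ s = ∫ s in (t - h₁)..(t + h₂), φ s := by
    refine intervalIntegral_eq_of_eq_zero hφc ha hb (fun s hs => ?_) fun s hs => ?_
    · have hle : κ * u₂ ≤ κ * u₁ := mul_le_mul_of_nonneg_left (hl (hs.1.trans hs.2)) hκ.le
      have := hω.concaveDrop_mono (D := κ * u₁) hp hq (by linarith [hs.2] : κ * u₁ ≤ c - s)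
      simp only [hφ, hdl s (by linarith [hs.2])]
      rw [hA, max_eq_left hle]
      exact max_eq_left (by linarith)
    · have hle : κ * u₁ ≤ κ * u₂ := mul_le_mul_of_nonneg_left (hr (hs.1.trans hs.2)) hκ.le
      have := hω.concaveDrop_mono (D := κ * u₂) hp hq (by linarith [hs.1] : κ * u₂ ≤ s - c)
      simp only [hφ, hdr s (by linarith [hs.1])]
      rw [hA, max_eq_right hle]
      exact max_eq_left (by linarith)
  refine ⟨φ, hdens, ?_⟩
  have e1 : t + γ₂ - (t - γ₁) = γ₁ + γ₂ := by ring
  have e2 : t + h₂ - (t - h₁) = h₁ + h₂ := by ring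
  have e3 : t - γ₁ - (t - h₁) = u₁ := by rw [hu₁]; ring
  have e4 : t + h₂ - (t + γ₂) = u₂ := by rw [hu₂]; ring
  have h := average_sub_average hφc (A := t - h₁) (m := t - γ₁) (n := t + γ₂) (D := t + h₂)
    (by linarith) (by linarith)
  rw [e1, e2, e3, e4, ← hwdef, ← hrdef] at h
  simp only [smul_eq_mul] at h
  -- For `D = κ u` the paired points of `average_sub_average` are exactly the matched points of
  -- `concaveDrop_matched`.
  have hmatch : ∀ D u : ℝ, D = κ * u → ∀ v, 0 ≤ v →
      concaveDrop ω p q D (r * u + v) - concaveDrop ω p q D (r * u - r * v) = ω (κ * v) := by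
    rintro _ u rfl v hv
    have x1 : p * (κ * u) + q * (κ * v) = r * u + v := by linear_combination u * hpκ + v * hqκ
    have x2 : p * (κ * u - κ * v) = r * u - r * v := by linear_combination (u - v) * hpκ
    have := hω.concaveDrop_matched (D := κ * u) hp hq (v := κ * v) (by positivity) hpq
    rwa [x1, x2] at this
  have i1 : ∫ u in (0 : ℝ)..u₁, (φ (t - γ₁ + r * u) - φ (t - γ₁ - u)) =
      ∫ u in (0 : ℝ)..u₁, ω (κ * u) := by
    refine intervalIntegral.integral_congr fun u hu => ?_
    rw [uIcc_of_le h01] at hu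
    have g1 : 0 ≤ r * u := mul_nonneg hr0.le hu.1
    have g2 : r * u ≤ r * u₁ := mul_le_mul_of_nonneg_left hu.2 hr0.le
    change φ (t - γ₁ + r * u) - φ (t - γ₁ - u) = ω (κ * u)
    rw [hinl _ (by linarith) (by linarith), hinl _ (by linarith [hu.2]) (by linarith [hu.1]),
      ← hmatch _ u₁ rfl u hu.1, sub_sub_sub_cancel_left]
    congr 2 <;> rw [hcdef] <;> ring
  have i2 : ∫ u in (0 : ℝ)..u₂, (φ (t + γ₂ - r * u) - φ (t + γ₂ + u)) =
      ∫ u in (0 : ℝ)..u₂, ω (κ * u) := by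
    refine intervalIntegral.integral_congr fun u hu => ?_
    rw [uIcc_of_le h02] at hu
    have g1 : 0 ≤ r * u := mul_nonneg hr0.le hu.1
    have g2 : r * u ≤ r * u₂ := mul_le_mul_of_nonneg_left hu.2 hr0.le
    change φ (t + γ₂ - r * u) - φ (t + γ₂ + u) = ω (κ * u)
    rw [hinr _ (by linarith) (by linarith), hinr _ (by linarith [hu.1]) (by linarith [hu.2]),
      ← hmatch _ u₂ rfl u hu.1, sub_sub_sub_cancel_left]
    congr 2 <;> rw [hc2] <;> ring
  rw [i1, i2] at h
  rw [hint]
  linarith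

end IsModulus

/-! ### The inequalities and their sharpness. -/

theorem mainTheorem10 {X : Type*} [LSpace X] (hX : IsIsotropic X)
    (hinv : invertibleElements X ∩ convexElements X ≠ {0})
    (P : X → X) (hP : IsConvexifying P)
    (a b : ℝ) (hab : a < b)
    (ω : ℝ → ℝ) (hω : IsModulus ω) (hω0 : ∃ s, 0 ≤ s ∧ ω s ≠ 0) :
    -- the two inequalities, with the existence of all the quantities in them
    (∀ f : ℝ → X, MemWBar P ω a b f →
      (∀ s ∈ Icc a b, ∃ d, HasHukuharaDeriv a b f s d) ∧
      BddAbove (omegaQuotients ω a b (hukuharaDeriv a b f)) ∧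
      BddAbove (normValues a b f) ∧
      (∀ t ∈ Icc a b, ∀ γ₁ γ₂ h₁ h₂ : ℝ, 0 ≤ γ₁ → 0 ≤ γ₂ → 0 ≤ h₁ → 0 ≤ h₂ →
        0 < γ₁ + γ₂ → 0 < h₁ + h₂ →
        Icc (t - γ₁) (t + γ₂) ⊆ Icc (t - h₁) (t + h₂) →
        Icc (t - h₁) (t + h₂) ⊆ Icc a b →
        (∃ z, IsHukuharaDiff (f (t + γ₂)) (f (t - γ₁)) z) ∧
        normL (dividedDiff γ₁ γ₂ f t) ≤
          landauK ω γ₁ γ₂ h₁ h₂ * normOmega ω a b (hukuharaDeriv a b f) +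
            2 / (h₁ + h₂) * normC a b f) ∧
      (∀ t ∈ Icc a b, ∀ h₁ h₂ : ℝ, 0 ≤ h₁ → 0 ≤ h₂ → 0 < h₁ + h₂ →
        Icc (t - h₁) (t + h₂) ⊆ Icc a b →
        normL (hukuharaDeriv a b f t) ≤
          (modulusIntegral ω h₁ + modulusIntegral ω h₂) / (h₁ + h₂) *
              normOmega ω a b (hukuharaDeriv a b f) +
            2 / (h₁ + h₂) * normC a b f)) ∧
    -- sharpness of the first inequality
    (ConcaveOn ℝ (Ici 0) ω →
      ∀ t ∈ Icc a b, ∀ γ h : ℝ, 0 < γ → γ < h →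
        ∀ γ₁ γ₂ h₁ h₂ : ℝ, γ₁ = min γ (t - a) → γ₂ = min γ (b - t) →
          h₁ = min h (t - a) → h₂ = min h (b - t) →
          ∃ f : ℝ → X, MemW P ω a b f ∧
            normOmega ω a b (hukuharaDeriv a b f) = 1 ∧ 0 < normC a b f ∧
            normL (dividedDiff γ₁ γ₂ f t) =
              landauK ω γ₁ γ₂ h₁ h₂ * normOmega ω a b (hukuharaDeriv a b f) +
                2 / (h₁ + h₂) * normC a b f) ∧
    -- sharpness of the second inequality
    (∀ t ∈ Icc a b, ∀ h : ℝ, 0 < h →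
      ∀ h₁ h₂ : ℝ, h₁ = min h (t - a) → h₂ = min h (b - t) →
        ∃ f : ℝ → X, MemW P ω a b f ∧
          normOmega ω a b (hukuharaDeriv a b f) = 1 ∧ 0 < normC a b f ∧
          normL (hukuharaDeriv a b f t) =
            (modulusIntegral ω h₁ + modulusIntegral ω h₂) / (h₁ + h₂) *
                normOmega ω a b (hukuharaDeriv a b f) +
              2 / (h₁ + h₂) * normC a b f) := by
  have hmin : ∀ {t h : ℝ}, t ∈ Icc a b → 0 < h →
      0 ≤ min h (t - a) ∧ 0 ≤ min h (b - t) ∧ 0 < min h (t - a) + min h (b - t) ∧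
        a ≤ t - min h (t - a) ∧ t + min h (b - t) ≤ b := fun {t h} ht hh => by
    have h1 := min_le_right h (t - a)
    have h2 := min_le_right h (b - t)
    have n1 : 0 ≤ min h (t - a) := le_min hh.le (by linarith [ht.1])
    have n2 : 0 ≤ min h (b - t) := le_min hh.le (by linarith [ht.2])
    refine ⟨n1, n2, ?_, by linarith, by linarith⟩
    rcases ht.1.lt_or_eq with ha | ha
    · exact add_pos_of_pos_of_nonneg (lt_min hh (by linarith)) n2
    · exact add_pos_of_nonneg_of_pos n1 (lt_min hh (by linarith))
  refine ⟨fun f hf => ?_, fun hc t ht γ h hγ hγh γ₁ γ₂ h₁ h₂ hγ₁ hγ₂ hh₁ hh₂ => ?_,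
    fun t ht h hh h₁ h₂ hh₁ hh₂ => ?_⟩
  · obtain ⟨B, _, _, _, j, hj⟩ := exists_isConeEmbedding hX hP
    obtain ⟨k, g, hg, hk⟩ := hf.exists_isHukuharaPrimitive hω hP hj
    refine ⟨fun s hs => ⟨g s, hg.hasHukuharaDeriv hab hX hP hj hs⟩,
      hg.bddAbove_omegaQuotients hab hX hP hj hω hω0 hk, hg.bddAbove_normValues hab hP hj,
      fun t _ γ₁ γ₂ h₁ h₂ hγ₁ hγ₂ hh₁ hh₂ hγ hh hsub hsub' => ?_,
      fun t _ h₁ h₂ hh₁ hh₂ hh hsub => ?_⟩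
    · obtain ⟨h1, h2⟩ := (Icc_subset_Icc_iff (by linarith)).1 hsub
      obtain ⟨h3, h4⟩ := (Icc_subset_Icc_iff (by linarith)).1 hsub'
      refine ⟨?_, hg.normL_dividedDiff_le hab hX hP hj hω hω0 hk (by linarith) (by linarith) hγ
        h3 h4⟩
      obtain ⟨z, -, hz, -⟩ := hg.increment (t - γ₁) ⟨by linarith, by linarith⟩ (t + γ₂)
        ⟨by linarith, by linarith⟩ (by linarith)
      exact ⟨z, hz⟩
    · obtain ⟨h3, h4⟩ := (Icc_subset_Icc_iff (by linarith)).1 hsub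
      exact hg.normL_hukuharaDeriv_le hab hX hP hj hω hω0 hk hh₁ hh₂ hh h3 h4
  · obtain ⟨n1, n2, n3, n4, n5⟩ := hmin ht hγ
    obtain ⟨m1, m2, m3, m4, m5⟩ := hmin ht (hγ.trans hγh)
    have c1 : min γ (t - a) ≤ min h (t - a) := min_le_min_right _ hγh.le
    have c2 : min γ (b - t) ≤ min h (b - t) := min_le_min_right _ hγh.le
    have gap : ∀ x, min h x - min γ x ≤ h - γ := fun x => by
      rcases le_total γ x with hx | hx
      · rw [min_eq_left hx]; linarith [min_le_left h x]
      · rw [min_eq_right hx]; linarith [min_le_right h x]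
    -- A side on which the outer interval does not reach the endpoint has the full gap `h - γ`, the
    -- largest possible by `gap`; this supplies the conditions that make the density vanish outside.
    have full : ∀ x, min h x < x → min h x - min γ x = h - γ := fun x hx => by
      have hhx : h < x := by
        by_contra! hle
        rw [min_eq_right hle] at hx
        exact lt_irrefl _ hx
      rw [min_eq_left hhx.le, min_eq_left (hγh.trans hhx).le]
    subst hγ₁ hγ₂ hh₁ hh₂
    obtain ⟨φ, hφ, hφeq⟩ : ∃ φ, IsExtremalDensity ω a b φ ∧
        (min γ (t - a) + min γ (b - t))⁻¹ *
            (∫ s in (t - min γ (t - a))..(t + min γ (b - t)), φ s) =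
          landauK ω (min γ (t - a)) (min γ (b - t)) (min h (t - a)) (min h (b - t)) +
            (min h (t - a) + min h (b - t))⁻¹ * ∫ s in a..b, φ s := by
      -- If the inner and outer intervals coincide, then both are `[a, b]`, since `γ < h`. The
      -- constant `K` is then zero and any extremal density serves; the tent is used.
      rcases (add_le_add c1 c2).eq_or_lt with heq | hlt
      · have d1 : min h (t - a) = min γ (t - a) := by linarith
        have d2 : min h (b - t) = min γ (b - t) := by linarith
        have t1 : min γ (t - a) = t - a := by
          by_contra hne
          have := full (t - a) (d1 ▸ lt_of_le_of_ne (min_le_right _ _) hne)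
          linarith
        have t2 : min γ (b - t) = b - t := by
          by_contra hne
          have := full (b - t) (d2 ▸ lt_of_le_of_ne (min_le_right _ _) hne)
          linarith
        refine ⟨_, hω.isExtremalDensity_tent hω0 n1 n2 n3 n4 n5, ?_⟩
        rw [d1, d2, t1, t2, sub_sub_cancel, add_sub_cancel]
        simp [landauK]
      · exact hω.exists_isExtremalDensity_average hω0 hc c1 c2 n3 hlt m4 m5
          (fun hl => (gap _).trans (full _ (by linarith)).ge)
          (fun hr => (gap _).trans (full _ (by linarith)).ge)
    obtain ⟨f, hf, hf1, hf2, hf3, hf4, -⟩ := hφ.exists_memW hX hinv hP hab hω hω0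
    refine ⟨f, hf, hf1, hf2, ?_⟩
    rw [hf4 t _ _ n4 n5 n3.le, hφeq, hf1, hf3]
    ring
  · obtain ⟨m1, m2, m3, m4, m5⟩ := hmin ht hh
    subst hh₁ hh₂
    obtain ⟨f, hf, hf1, hf2, hf3, -, hf5⟩ :=
      (hω.isExtremalDensity_tent hω0 m1 m2 m3 m4 m5).exists_memW hX hinv hP hab hω hω0
    refine ⟨f, hf, hf1, hf2, ?_⟩
    -- A half-interval that stops short of the endpoint has length `h`, hence is at least as long as
    -- the other one.
    have hfull : ∀ x, min h x < x → h ≤ min h x := fun x hx => by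
      rcases min_choice h x with he | he
      · exact he.ge
      · exact absurd he hx.ne
    rw [hf5 t ht, hω.tent_eq_average_add m1 m2 m3 m4 m5
      (fun hl => (min_le_left _ _).trans (hfull _ (by linarith)))
      (fun hr => (min_le_left _ _).trans (hfull _ (by linarith))) rfl, hf1, hf3]
    ring
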